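/- **Proposition 3.1.** Let $M$ be a compact complex surface and $L$ a holomorphic line bundle on $M$. Let $$\omega_\epsilon=\omega_0+\epsilon\omega_1+\epsilon^2\omega_2+\cdots,\qquad \omega_i\in H^0(M,\Omega^1\otimes L),\quad \epsilon\in(\mathbb C,0),$$ be a holomorphic family such that each $\omega_\epsilon$ has only isolated zeros, and let $\mathcal F_\epsilon$ be the foliation $\omega_\epsilon=0$. Let $s$ be a meromorphic section of $L$ and $f$ a meromorphic function on $M$ with $\omega_0/s=df$. Let $\delta:[0,1]\to M$ be a $C^1$ loop contained in a leaf of $\mathcal F_0$ such that, along $\delta$, $f$ and $s$ are holomorphic and $s$ has no zeros. Let $\Sigma\simeq(\mathbb C,0)$ be a germ of holomorphic curve through the point $p=\delta(0)=\delta(1)$ which is parameterized by $t=f|_\Sigma$ (so $f(p)=0$ and $\Sigma$ is transverse to $\mathcal F_0$). Let $h_\epsilon(t)$, for $(t,\epsilon)$ near $(0,0)$, be the holonomy of $\mathcal F_\epsilon$ along $\delta$: there are paths $\Gamma_{t,\epsilon}:[0,1]\to M$, depending continuously on $(t,\epsilon)$ in the $C^1$ sense, such that $\Gamma_{0,0}=\delta$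 and $\Gamma_{t,\epsilon}$ lies in a leaf of $\mathcal F_\epsilon$ and goes from the point of $\Sigma$ with parameter $t$ to the point of $\Sigma$ with parameter $h_\epsilon(t)$, where $h_\epsilon(t)\to h_0(0)=0$ as $(t,\epsilon)\to(0,0)$. Assume that the holonomy of $\mathcal F_0$ is the identity, $h_0(t)\equiv t$, and let $\delta_t$ be the lift of $\delta$ to the leaf of $\mathcal F_0$ through $t\in\Sigma$, i.e. $(\delta_t)_{t\in(\mathbb C,0)}$ is a family, continuous in the $C^1$ sense, of loops in leaves of $\mathcal F_0$ based at the points $t\in\Sigma$, with $\delta_0=\delta$. Then, for all $t$ near $0$, $h_\epsilon(t)$ is complex differentiable in $\epsilon$ at $\epsilon=0$, and the first Melnikov function $M_1(t)=\left.\frac{\partial}{\partial\epsilon}\right|_{\epsilon=0}\bigl(h_\epsilon(t)-t\bigr)$, the coefficient of $\epsilon$ in $h_\epsilon(t)-t=M_1(t)\epsilon+M_2(t)\epsilon^2+\cdots$, is given by $$M_1(t)=-\int_{\delta_t}\frac{\omega_1}{s}.$$ -/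

import Mathlib

open Set Filter Topology Bundle
open scoped Manifold ContDiff

/-- The model space `ℂ²` of complex surfaces. A complex surface is a space `M` with
`[ChartedSpace C2 M] [IsManifold 𝓘(ℂ, C2) ω M]` (`ω` is analytic, i.e. holomorphic over `ℂ`). -/
abbrev C2 : Type := EuclideanSpace ℂ (Fin 2)

namespace MelnikovFoliation

noncomputable section

section Forms

variable {M : Type*} [TopologicalSpace M] [ChartedSpace C2 M] [IsManifold 𝓘(ℂ, C2) ω M]
  (L : M → Type*) [TopologicalSpace (TotalSpace ℂ L)]
  [∀ x, AddCommGroup (L x)] [∀ x, Module ℂ (L x)] [∀ x, TopologicalSpace (L x)]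

/-- `L`-valued `1`-forms on `M` (set-theoretic sections of `Ω¹ ⊗ L = Hom(TM, L)`). -/
abbrev TwistedForm : Type _ := ∀ x : M, TangentSpace 𝓘(ℂ, C2) x →L[ℂ] L x

variable {L}
variable [FiberBundle ℂ L] [VectorBundle ℂ ℂ L]
  [∀ x, IsTopologicalAddGroup (L x)] [∀ x, ContinuousSMul ℂ (L x)]

/-- `η ∈ H⁰(M, Ω¹ ⊗ L)`: `η` is a global holomorphic section of the bundle `Hom(TM, L)`. -/
def IsHolomorphicForm (η : TwistedForm L) : Prop :=
  ContMDiff 𝓘(ℂ, C2) (𝓘(ℂ, C2).prod 𝓘(ℂ, C2 →L[ℂ] ℂ)) ω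
    (fun x : M => TotalSpace.mk' (C2 →L[ℂ] ℂ)
      (E := fun y : M => TangentSpace 𝓘(ℂ, C2) y →L[ℂ] L y) x (η x))

/-- `η` defines a holomorphic foliation with isolated singularities, of degree `L`:
it is a holomorphic section of `Ω¹ ⊗ L` without zero divisor, i.e. with isolated zeros. -/
def IsFoliation (η : TwistedForm L) : Prop :=
  IsHolomorphicForm η ∧ ∀ x : M, ∀ᶠ y in 𝓝[≠] x, η y ≠ 0

/-- `η ε`, for `ε ∈ (ℂ, 0)`, is a holomorphic family of foliations of degree `L`, and
`η ε = c 0 + ε c 1 + ε² c 2 + ⋯` is its expansion with coefficients in `H⁰(M, Ω¹ ⊗ L)`. -/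
def IsHolomorphicDeformation (η : ℂ → TwistedForm L) (c : ℕ → TwistedForm L) : Prop :=
  (∀ i, IsHolomorphicForm (c i)) ∧
  ∃ r : ℝ, 0 < r ∧
    ContMDiffOn (𝓘(ℂ, C2).prod 𝓘(ℂ, ℂ)) (𝓘(ℂ, C2).prod 𝓘(ℂ, C2 →L[ℂ] ℂ)) ω
      (fun q : M × ℂ => TotalSpace.mk' (C2 →L[ℂ] ℂ)
        (E := fun y : M => TangentSpace 𝓘(ℂ, C2) y →L[ℂ] L y) q.1 (η q.2 q.1))
      (univ ×ˢ Metric.ball (0 : ℂ) r) ∧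
    ∀ ε ∈ Metric.ball (0 : ℂ) r, IsFoliation (η ε) ∧
      ∀ (x : M) (v : TangentSpace 𝓘(ℂ, C2) x), HasSum (fun i => ε ^ i • c i x v) (η ε x v)

/-- `s` is a meromorphic section of `L`, regular (holomorphic) on the dense open set `D`:
locally it is a quotient `g / k` of a holomorphic section `g` of `L` and a holomorphic function
`k` that vanishes identically on no open set. The values of `s` outside `D` are irrelevant. -/
structure IsMeromorphicSection (s : ∀ x : M, L x) (D : Set M) : Prop where
  isOpen : IsOpen D
  dense : Dense D
  holo : ContMDiffOn 𝓘(ℂ, C2) (𝓘(ℂ, C2).prod 𝓘(ℂ, ℂ)) ω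
    (fun x : M => TotalSpace.mk' ℂ (E := L) x (s x)) D
  quot : ∀ x : M, ∃ U : Set M, IsOpen U ∧ x ∈ U ∧ ∃ (g : ∀ y : M, L y) (k : M → ℂ),
    ContMDiffOn 𝓘(ℂ, C2) (𝓘(ℂ, C2).prod 𝓘(ℂ, ℂ)) ω
      (fun y : M => TotalSpace.mk' ℂ (E := L) y (g y)) U ∧
    ContMDiffOn 𝓘(ℂ, C2) 𝓘(ℂ, ℂ) ω k U ∧ U ⊆ closure {y ∈ U | k y ≠ 0} ∧
    ∀ y ∈ U ∩ D, k y • s y = g y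

/-- The meromorphic `1`-form `η / s` at the point `x`, applied to the tangent vector `v`: the
quotient of two elements `η x v` and `s x ≠ 0` of the line `L x`, computed in a trivialization of
`L` (see `formQuot_smul`). -/
def formQuot (η : TwistedForm L) (s : ∀ x : M, L x) (x : M) (v : TangentSpace 𝓘(ℂ, C2) x) : ℂ :=
  (trivializationAt ℂ L x (TotalSpace.mk' ℂ x (η x v))).2 /
    (trivializationAt ℂ L x (TotalSpace.mk' ℂ x (s x))).2

end Forms

section Functions

variable {M : Type*} [TopologicalSpace M] [ChartedSpace C2 M]

/-- `f` is a meromorphic function on `M`, regular (holomorphic) on the dense open set `D`. -/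
structure IsMeromorphicFunction (f : M → ℂ) (D : Set M) : Prop where
  isOpen : IsOpen D
  dense : Dense D
  holo : ContMDiffOn 𝓘(ℂ, C2) 𝓘(ℂ, ℂ) ω f D
  quot : ∀ x : M, ∃ U : Set M, IsOpen U ∧ x ∈ U ∧ ∃ g k : M → ℂ,
    ContMDiffOn 𝓘(ℂ, C2) 𝓘(ℂ, ℂ) ω g U ∧ ContMDiffOn 𝓘(ℂ, C2) 𝓘(ℂ, ℂ) ω k U ∧
    U ⊆ closure {y ∈ U | k y ≠ 0} ∧ ∀ y ∈ U ∩ D, k y * f y = g y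

/-- The differential of `f` at `x`, applied to `v`, as a complex number. -/
def dif (f : M → ℂ) (x : M) (v : TangentSpace 𝓘(ℂ, C2) x) : ℂ :=
  mfderiv 𝓘(ℂ, C2) 𝓘(ℂ, ℂ) f x v

/-- The velocity `γ'(τ)` of a path `γ : [0, 1] → M` (one-sided at the end points). It is computed
in the underlying real manifold, whose tangent spaces are those of `M`. -/
def velocity (γ : ℝ → M) (τ : ℝ) : TangentSpace 𝓘(ℂ, C2) (γ τ) :=
  (mfderivWithin 𝓘(ℝ, ℝ) 𝓘(ℝ, C2) γ (Icc 0 1) τ (1 : ℝ) : C2)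

end Functions

section Holonomy

variable {M : Type*} [TopologicalSpace M] [ChartedSpace C2 M] [IsManifold 𝓘(ℂ, C2) ω M]
  {L : M → Type*} [∀ x, AddCommGroup (L x)] [∀ x, Module ℂ (L x)] [∀ x, TopologicalSpace (L x)]

/-- `γ : [0, 1] → M` is a `C¹` path in a leaf of the foliation `η = 0`: it is tangent to the kernel
of `η` and avoids the singularities. -/
def IsLeafPath (η : TwistedForm L) (γ : ℝ → M) : Prop :=
  ContMDiffOn 𝓘(ℝ, ℝ) 𝓘(ℝ, C2) 1 γ (Icc 0 1) ∧
    ∀ τ ∈ Icc (0 : ℝ) 1, η (γ τ) ≠ 0 ∧ η (γ τ) (velocity γ τ) = 0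

/-- `Γ` lifts the path `δ` to the leaves of a family of foliations `η p`, `p ∈ (P, p₀)`: for `p` near
`p₀`, `Γ p` is a path in a leaf of `η p` from `a p` to `b p`, depending continuously on `p`
(in the `C¹` sense), and `Γ p₀ = δ`. -/
def IsLeafLift {P : Type*} [TopologicalSpace P] (η : P → TwistedForm L) (δ : ℝ → M) (p₀ : P)
    (a b : P → M) (Γ : P → ℝ → M) : Prop :=
  (∀ τ ∈ Icc (0 : ℝ) 1, Γ p₀ τ = δ τ) ∧
  ∃ N ∈ 𝓝 p₀,
    (∀ p ∈ N, IsLeafPath (η p) (Γ p) ∧ Γ p 0 = a p ∧ Γ p 1 = b p) ∧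
    ContinuousOn (fun q : P × ℝ =>
      (⟨Γ q.1 q.2, velocity (Γ q.1) q.2⟩ : TangentBundle 𝓘(ℂ, C2) M)) (N ×ˢ Icc (0 : ℝ) 1)

/-- `h ε t = h_ε(t)` is (a representative of the germ at `(0, 0)` of) the holonomy along the loop
`δ` of the foliations `η ε`, `ε ∈ (ℂ, 0)`, on the transverse section `Σ` parameterized by `σ`:
lifting `δ` to the leaf of `η ε` through the point `σ t` leads back to `Σ` at the point
`σ (h ε t)`. -/
def IsHolonomy (η : ℂ → TwistedForm L) (δ : ℝ → M) (σ : ℂ → M) (h : ℂ → ℂ → ℂ) : Prop :=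
  Tendsto (fun p : ℂ × ℂ => h p.2 p.1) (𝓝 (0, 0)) (𝓝 0) ∧
  ∃ Γ : ℂ × ℂ → ℝ → M, IsLeafLift (fun p : ℂ × ℂ => η p.2) δ (0, 0)
    (fun p => σ p.1) (fun p => σ (h p.2 p.1)) Γ

/-- The `i`-th Melnikov function, the coefficient of `ε ^ i` in `h_ε(t) - t`. -/
def melnikov (h : ℂ → ℂ → ℂ) (i : ℕ) (t : ℂ) : ℂ :=
  iteratedDeriv i (fun ε => h ε t - t) 0 / (i.factorial : ℂ)

end Holonomy

section Check

variable {M : Type*} [TopologicalSpace M] [ChartedSpace C2 M]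
  {L : M → Type*} [TopologicalSpace (TotalSpace ℂ L)]
  [∀ x, AddCommGroup (L x)] [∀ x, Module ℂ (L x)] [∀ x, TopologicalSpace (L x)]
  [FiberBundle ℂ L] [VectorBundle ℂ ℂ L]

/-- `formQuot` is the quotient in the line `L x`. -/
theorem formQuot_smul (η : TwistedForm L) (s : ∀ x : M, L x) (x : M)
    (v : TangentSpace 𝓘(ℂ, C2) x) (hs : s x ≠ 0) : formQuot η s x v • s x = η x v := by
  have hx : x ∈ (trivializationAt ℂ L x).baseSet := FiberBundle.mem_baseSet_trivializationAt' x
  let A := (trivializationAt ℂ L x).continuousLinearEquivAt ℂ x hx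
  have hA : ∀ y : L x, (trivializationAt ℂ L x (TotalSpace.mk' ℂ x y)).2 = A y := fun _ => rfl
  have h0 : A (s x) ≠ 0 := fun h => hs (A.injective (by simpa using h))
  apply A.injective
  rw [map_smul, formQuot, hA, hA, smul_eq_mul, div_mul_cancel₀ _ h0]

end Check

end

end MelnikovFoliation

/-! Write $\omega_\epsilon=\omega_0+\epsilon\theta_\epsilon$, where $\theta_\epsilon$ (`slopeForm`)
is the difference quotient and $\theta_0=\omega_1$. The velocity of $\Gamma_{t,\epsilon}$ is killed
by $\omega_\epsilon$. Dividing by $s$, which is holomorphic without zeros near $\delta$, gives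
$df=-\epsilon\,\theta_\epsilon/s$ on this velocity. Since $f$ is the parameter of $\Sigma$,
integration yields, for small $\epsilon\ne0$, the exact identity
$h_\epsilon(t)-t=-\epsilon\int_{\Gamma_{t,\epsilon}}\theta_\epsilon/s$.

The function $\theta_\epsilon/s$ is continuous at $\epsilon=0$ jointly in $\epsilon$ and the tangent
vector (`tendsto_formQuot_slopeForm`), and $\Gamma_{t,\epsilon}$ is $C^1$-continuous in $\epsilon$.
So the integrals converge, and $\partial_\epsilon
h_\epsilon(t)|_{\epsilon=0}=-\int_{\Gamma_{t,0}}\omega_1/s$ (`hasDerivAt_of_leafPaths`).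

It remains to replace $\Gamma_{t,0}$ by $\delta_t$. Both lie in $\{f=t\}$, both are close to
$\delta$, and they have the same end points because $h_0(t)=t$. A holomorphic 1-form restricted to a
complex curve is closed, so $\omega_1/s$ has primitives on the plaques of flow boxes whose first
coordinate is $f$. Finitely many boxes cover $\delta$; the difference of the two integrals, followed
from box to box, is always the increment of a local primitive, and it vanishes at the common end
point (`eventually_integral_eq`). -/

open Set Filter Topology Bundle
open scoped Manifold ContDiff

set_option linter.unusedSectionVars false

namespace MelnikovFoliation

noncomputable section

/-! ### Holomorphic maps on the underlying real manifolds -/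

section RestrictScalars

variable {E E' : Type*} [NormedAddCommGroup E] [NormedSpace ℂ E] [NormedAddCommGroup E']
  [NormedSpace ℂ E'] {M N : Type*} [TopologicalSpace M] [ChartedSpace E M]
  [TopologicalSpace N] [ChartedSpace E' N]

/-- A holomorphic map is smooth between the underlying real manifolds. -/
theorem contMDiffAt_restrictScalars {n : WithTop ℕ∞} {g : M → N} {x : M}
    (hg : ContMDiffAt 𝓘(ℂ, E) 𝓘(ℂ, E') n g x) : ContMDiffAt 𝓘(ℝ, E) 𝓘(ℝ, E') n g x := by
  rw [contMDiffAt_iff] at hg ⊢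
  exact ⟨hg.1, hg.2.restrict_scalars ℝ⟩

/-- The complex differential is the differential of the underlying real map. -/
theorem hasMFDerivAt_restrictScalars {g : M → N} {x : M}
    {g' : E →L[ℂ] E'} (hg : HasMFDerivAt 𝓘(ℂ, E) 𝓘(ℂ, E') g x g') :
    HasMFDerivAt 𝓘(ℝ, E) 𝓘(ℝ, E') g x (show E →L[ℝ] E' from g'.restrictScalars ℝ) := by
  refine ⟨hg.1, ?_⟩
  have := hg.2
  exact HasFDerivWithinAt.restrictScalars ℝ this

end RestrictScalars

/-! ### Calculus along paths -/

section Paths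

variable {M : Type*} [TopologicalSpace M] [ChartedSpace C2 M]
  {E : Type*} [NormedAddCommGroup E] [NormedSpace ℂ E]

/-- Chain rule for a holomorphic map along a path. -/
theorem hasDerivWithinAt_comp_path {g : M → E} {γ : ℝ → M} {τ : ℝ}
    (hγ : ContMDiffWithinAt 𝓘(ℝ, ℝ) 𝓘(ℝ, C2) 1 γ (Icc 0 1) τ)
    (hg : MDifferentiableAt 𝓘(ℂ, C2) 𝓘(ℂ, E) g (γ τ)) :
    HasDerivWithinAt (F := E) (fun u => g (γ u))
      (mfderiv 𝓘(ℂ, C2) 𝓘(ℂ, E) g (γ τ) (velocity γ τ)) (Icc 0 1) τ := by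
  have h1 := (hγ.mdifferentiableWithinAt one_ne_zero).hasMFDerivWithinAt
  have h2 := hasMFDerivAt_restrictScalars hg.hasMFDerivAt
  have h3 := (h2.comp_hasMFDerivWithinAt τ h1).hasFDerivWithinAt
  have h4 : HasFDerivWithinAt (𝕜 := ℝ) (E := ℝ) (F := E) (fun u => g (γ u))
      (show ℝ →L[ℝ] E from ((show C2 →L[ℂ] E from mfderiv 𝓘(ℂ, C2) 𝓘(ℂ, E) g (γ τ)).restrictScalars ℝ).comp
        (show ℝ →L[ℝ] C2 from mfderivWithin 𝓘(ℝ, ℝ) 𝓘(ℝ, C2) γ (Icc 0 1) τ)) (Icc 0 1) τ := h3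
  exact h4.hasDerivWithinAt

theorem contDiffWithinAt_comp_path {g : M → E} {γ : ℝ → M} {τ : ℝ}
    (hγ : ContMDiffWithinAt 𝓘(ℝ, ℝ) 𝓘(ℝ, C2) 1 γ (Icc 0 1) τ)
    (hg : ContMDiffAt 𝓘(ℂ, C2) 𝓘(ℂ, E) 1 g (γ τ)) :
    ContDiffWithinAt ℝ 1 (fun u => g (γ u)) (Icc 0 1) τ := by
  have h := (contMDiffAt_restrictScalars hg).comp_contMDiffWithinAt τ hγ
  exact contMDiffWithinAt_iff_contDiffWithinAt.1 h

/-- A path at which `f ∘ γ` has vanishing derivative everywhere is contained in a level of `f`. -/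
theorem eq_of_dif_velocity_eq_zero {f : M → ℂ} {γ : ℝ → M}
    (hγ : ContMDiffOn 𝓘(ℝ, ℝ) 𝓘(ℝ, C2) 1 γ (Icc 0 1))
    (hf : ∀ τ ∈ Icc (0 : ℝ) 1, MDifferentiableAt 𝓘(ℂ, C2) 𝓘(ℂ, ℂ) f (γ τ))
    (h0 : ∀ τ ∈ Icc (0 : ℝ) 1, dif f (γ τ) (velocity γ τ) = 0) :
    ∀ τ ∈ Icc (0 : ℝ) 1, f (γ τ) = f (γ 0) := by
  have hd : ∀ τ ∈ Icc (0 : ℝ) 1, HasDerivWithinAt (fun u => f (γ u)) 0 (Icc 0 1) τ := by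
    intro τ hτ
    have := hasDerivWithinAt_comp_path (hγ τ hτ) (hf τ hτ)
    rw [← h0 τ hτ]
    exact this
  refine constant_of_has_deriv_right_zero (fun τ hτ => (hd τ hτ).continuousWithinAt) ?_
  intro τ hτ
  exact (hd τ (Ico_subset_Icc_self hτ)).mono_of_mem_nhdsWithin (Icc_mem_nhdsGE_of_mem hτ)

/-- The integrand is the derivative of the $C^1$ function $f\circ\gamma$ on $[0,1]$, hence
continuous there. -/
theorem intervalIntegrable_dif_velocity {f : M → ℂ} {γ : ℝ → M}
    (hγ : ContMDiffOn 𝓘(ℝ, ℝ) 𝓘(ℝ, C2) 1 γ (Icc 0 1))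
    (hf : ∀ τ ∈ Icc (0 : ℝ) 1, ContMDiffAt 𝓘(ℂ, C2) 𝓘(ℂ, ℂ) 1 f (γ τ)) :
    IntervalIntegrable (fun τ => dif f (γ τ) (velocity γ τ)) MeasureTheory.volume 0 1 := by
  have hd : ∀ τ ∈ Icc (0 : ℝ) 1, HasDerivWithinAt (fun u => f (γ u))
      (dif f (γ τ) (velocity γ τ)) (Icc 0 1) τ := fun τ hτ =>
    hasDerivWithinAt_comp_path (hγ τ hτ) ((hf τ hτ).mdifferentiableAt one_ne_zero)
  have hc : ContDiffOn ℝ 1 (fun u => f (γ u)) (Icc 0 1) := fun τ hτ =>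
    contDiffWithinAt_comp_path (hγ τ hτ) (hf τ hτ)
  refine ContinuousOn.intervalIntegrable ?_
  rw [uIcc_of_le zero_le_one]
  exact (hc.continuousOn_derivWithin (uniqueDiffOn_Icc zero_lt_one) le_rfl).congr fun τ hτ =>
    ((hd τ hτ).derivWithin (uniqueDiffOn_Icc zero_lt_one τ hτ)).symm

/-- Fundamental theorem of calculus for a holomorphic function along a path. -/
theorem integral_dif_velocity {f : M → ℂ} {γ : ℝ → M}
    (hγ : ContMDiffOn 𝓘(ℝ, ℝ) 𝓘(ℝ, C2) 1 γ (Icc 0 1))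
    (hf : ∀ τ ∈ Icc (0 : ℝ) 1, ContMDiffAt 𝓘(ℂ, C2) 𝓘(ℂ, ℂ) 1 f (γ τ)) :
    ∫ τ in (0 : ℝ)..1, dif f (γ τ) (velocity γ τ) = f (γ 1) - f (γ 0) := by
  have hd : ∀ τ ∈ Icc (0 : ℝ) 1, HasDerivWithinAt (fun u => f (γ u))
      (dif f (γ τ) (velocity γ τ)) (Icc 0 1) τ := fun τ hτ =>
    hasDerivWithinAt_comp_path (hγ τ hτ) ((hf τ hτ).mdifferentiableAt one_ne_zero)
  refine intervalIntegral.integral_eq_sub_of_hasDerivAt_of_le zero_le_one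
    (fun τ hτ => (hd τ hτ).continuousWithinAt) (fun τ hτ => ?_)
    (intervalIntegrable_dif_velocity hγ hf)
  exact (hd τ (Ioo_subset_Icc_self hτ)).hasDerivAt (Icc_mem_nhds hτ.1 hτ.2)

end Paths

/-! ### Difference quotients of holomorphic families -/

section Slope

variable {E : Type*} [NormedAddCommGroup E] [NormedSpace ℂ E]

/-- The derivative at the origin of the sum of a power series. -/
theorem hasDerivAt_of_hasSum_pow {a : ℕ → ℂ} {F : ℂ → ℂ} {r : ℝ} (hr : 0 < r)
    (h : ∀ ε ∈ Metric.ball (0 : ℂ) r, HasSum (fun i => ε ^ i • a i) (F ε)) :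
    HasDerivAt F (a 1) 0 := by
  have hp : HasFPowerSeriesAt F (FormalMultilinearSeries.ofScalars ℂ a) 0 := by
    rw [hasFPowerSeriesAt_iff]
    filter_upwards [Metric.ball_mem_nhds (0 : ℂ) hr] with ε hε
    simpa [FormalMultilinearSeries.coeff_ofScalars] using h ε hε
  simpa using hp.hasDerivAt

variable {M : Type*} [TopologicalSpace M] [ChartedSpace C2 M] [IsManifold 𝓘(ℂ, C2) ω M]

/-- Joint continuity, at parameter `0`, of the difference quotients of a holomorphic family. -/
theorem tendsto_slope_family {A : M × ℂ → E} {x₀ : M} {d : E}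
    (hA : ContMDiffAt (𝓘(ℂ, C2).prod 𝓘(ℂ, ℂ)) 𝓘(ℂ, E) ω A (x₀, 0))
    (hd : HasDerivAt (fun ε => A (x₀, ε)) d 0) :
    Tendsto (fun q : M × ℂ => q.2⁻¹ • (A q - A (q.1, 0))) (𝓝 x₀ ×ˢ 𝓝[≠] 0) (𝓝 d) := by
  set φ := extChartAt 𝓘(ℂ, C2) x₀ with hφ
  set B : C2 × ℂ → E := fun z => A (φ.symm z.1, z.2) with hB
  have hsymm : φ.symm (φ x₀) = x₀ := extChartAt_to_inv x₀
  have h1 : ContMDiffAt 𝓘(ℂ, C2) 𝓘(ℂ, C2) ω φ.symm (φ x₀) :=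
    (contMDiffOn_extChartAt_symm x₀).contMDiffAt (extChartAt_target_mem_nhds x₀)
  have h2 : ContMDiffAt 𝓘(ℂ, C2 × ℂ) (𝓘(ℂ, C2).prod 𝓘(ℂ, ℂ)) ω
      (fun z : C2 × ℂ => (φ.symm z.1, z.2)) (φ x₀, 0) :=
    (ContMDiffAt.comp (φ x₀, (0 : ℂ)) h1 contDiffAt_fst.contMDiffAt).prodMk
      contDiffAt_snd.contMDiffAt
  have h3 : ContMDiffAt 𝓘(ℂ, C2 × ℂ) 𝓘(ℂ, E) ω B (φ x₀, 0) :=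
    ContMDiffAt.comp (φ x₀, (0 : ℂ)) (by simpa [hsymm] using hA) h2
  -- Strict differentiability compares $B$ at two moving points. Applied to the pair
  -- $(\varphi(x),\epsilon)$, $(\varphi(x),0)$, it gives an error $o(\epsilon)$ uniform in $x$ near
  -- $x_0$.
  have h4 : HasStrictFDerivAt B (fderiv ℂ B (φ x₀, 0)) (φ x₀, 0) :=
    h3.contDiffAt.hasStrictFDerivAt (by simp)
  have hd' : fderiv ℂ B (φ x₀, 0) (0, 1) = d := by
    have h5 : HasDerivAt (fun ε : ℂ => ((φ x₀, ε) : C2 × ℂ)) ((0, 1) : C2 × ℂ) 0 :=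
      (hasDerivAt_const _ _).prodMk (hasDerivAt_id _)
    have h6 := h4.hasFDerivAt.comp_hasDerivAt (0 : ℂ) h5
    refine h6.unique ?_
    simpa [Function.comp_def, hB, hsymm] using hd
  have hcoord : Tendsto (fun q : M × ℂ => (((φ q.1, q.2), (φ q.1, 0)) : (C2 × ℂ) × (C2 × ℂ)))
      (𝓝 x₀ ×ˢ 𝓝[≠] 0) (𝓝 ((φ x₀, 0), (φ x₀, 0))) := by
    have hx : Tendsto (fun q : M × ℂ => φ q.1) (𝓝 x₀ ×ˢ 𝓝[≠] 0) (𝓝 (φ x₀)) :=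
      (continuousAt_extChartAt x₀).tendsto.comp tendsto_fst
    have hε : Tendsto (fun q : M × ℂ => q.2) (𝓝 x₀ ×ˢ 𝓝[≠] 0) (𝓝 0) :=
      tendsto_snd.mono_right nhdsWithin_le_nhds
    exact (hx.prodMk_nhds hε).prodMk_nhds (hx.prodMk_nhds tendsto_const_nhds)
  have hlo := (hasStrictFDerivAt_iff_isLittleO.1 h4).comp_tendsto hcoord
  have hsrc : ∀ᶠ q : M × ℂ in 𝓝 x₀ ×ˢ 𝓝[≠] 0, q.1 ∈ φ.source ∧ q.2 ≠ 0 :=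
    (tendsto_fst.eventually (extChartAt_source_mem_nhds x₀)).and
      (tendsto_snd.eventually self_mem_nhdsWithin)
  rw [tendsto_iff_norm_sub_tendsto_zero]
  have hlo2 : (fun q : M × ℂ => A q - A (q.1, 0) - q.2 • d) =o[𝓝 x₀ ×ˢ 𝓝[≠] 0]
      (fun q : M × ℂ => q.2) := by
    have hb : (fun q : M × ℂ => ((0, q.2) : C2 × ℂ)) =O[𝓝 x₀ ×ˢ 𝓝[≠] 0]
        (fun q : M × ℂ => q.2) := Asymptotics.isBigO_of_le _ fun q => by simp [Prod.norm_def]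
    refine (hlo.congr' ?_ ?_).trans_isBigO hb
    · filter_upwards [hsrc] with q hq
      have hl : φ.symm (φ q.1) = q.1 := φ.left_inv hq.1
      have : fderiv ℂ B (φ x₀, 0) (0, q.2) = q.2 • d := by
        rw [← hd', ← map_smul]; simp
      have hsub : ((φ q.1, q.2) : C2 × ℂ) - (φ q.1, 0) = (0, q.2) := by simp
      simp only [Function.comp_apply, hsub, this]
      simp only [hB, hl]
    · exact .of_forall fun q => by simp
  refine (hlo2.norm_left.norm_right.tendsto_div_nhds_zero).congr' ?_
  filter_upwards [hsrc] with q hq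
  have e1 : q.2⁻¹ • (A q - A (q.1, 0)) - d = q.2⁻¹ • (A q - A (q.1, 0) - q.2 • d) := by
    rw [smul_sub q.2⁻¹ _ (q.2 • d), inv_smul_smul₀ hq.2]
  rw [e1, norm_smul, norm_inv]
  simp [div_eq_inv_mul]

end Slope

/-! ### Twisted forms in local trivializations -/

section Quotients

variable {M : Type*} [TopologicalSpace M] [ChartedSpace C2 M] [IsManifold 𝓘(ℂ, C2) ω M]
  {L : M → Type*} [TopologicalSpace (TotalSpace ℂ L)]
  [∀ x, AddCommGroup (L x)] [∀ x, Module ℂ (L x)] [∀ x, TopologicalSpace (L x)]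
  [FiberBundle ℂ L] [VectorBundle ℂ ℂ L]

/-- A form in the trivializations of `TM` and `L` at `x₀`. -/
def formCoord (x₀ : M) (η : TwistedForm L) (x : M) : C2 →L[ℂ] ℂ :=
  ContinuousLinearMap.inCoordinates C2 (TangentSpace 𝓘(ℂ, C2)) ℂ L x₀ x x₀ x (η x)

/-- A section in the trivialization of `L` at `x₀`. -/
def sectionCoord (x₀ : M) (s : ∀ x : M, L x) (x : M) : ℂ :=
  (trivializationAt ℂ L x₀ (TotalSpace.mk' ℂ x (s x))).2

theorem sectionCoord_ne_zero_iff {x₀ x : M} {s : ∀ x : M, L x}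
    (hx : x ∈ (trivializationAt ℂ L x₀).baseSet) : sectionCoord x₀ s x ≠ 0 ↔ s x ≠ 0 := by
  let A := (trivializationAt ℂ L x₀).continuousLinearEquivAt ℂ x hx
  have hA : sectionCoord x₀ s x = A (s x) := rfl
  rw [hA]
  simp

theorem formCoord_apply {x₀ x : M} (η : TwistedForm L)
    (hx : x ∈ (trivializationAt ℂ L x₀).baseSet)
    (hx' : x ∈ (trivializationAt C2 (TangentSpace 𝓘(ℂ, C2)) x₀).baseSet)
    (v : TangentSpace 𝓘(ℂ, C2) x) :
    formCoord x₀ η x (trivializationAt C2 (TangentSpace 𝓘(ℂ, C2)) x₀ (TotalSpace.mk' C2 x v)).2 =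
      (trivializationAt ℂ L x₀).continuousLinearEquivAt ℂ x hx (η x v) := by
  rw [formCoord, ContinuousLinearMap.inCoordinates_eq hx' hx]
  have : (trivializationAt C2 (TangentSpace 𝓘(ℂ, C2)) x₀ (TotalSpace.mk' C2 x v)).2 =
    (trivializationAt C2 (TangentSpace 𝓘(ℂ, C2)) x₀).continuousLinearEquivAt ℂ x hx' v := rfl
  rw [this]
  simp only [ContinuousLinearMap.comp_apply, ContinuousLinearEquiv.coe_coe,
    ContinuousLinearEquiv.symm_apply_apply]

theorem formCoord_eq {x₀ x : M} (η : TwistedForm L)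
    (hx : x ∈ (trivializationAt ℂ L x₀).baseSet)
    (hx' : x ∈ (trivializationAt C2 (TangentSpace 𝓘(ℂ, C2)) x₀).baseSet) (w : C2) :
    formCoord x₀ η x w = (trivializationAt ℂ L x₀).continuousLinearEquivAt ℂ x hx (η x
      (((trivializationAt C2 (TangentSpace 𝓘(ℂ, C2)) x₀).continuousLinearEquivAt ℂ x hx').symm
        w)) := by
  rw [formCoord, ContinuousLinearMap.inCoordinates_eq hx' hx]
  rfl

/-- `formQuot` in the trivializations at `x₀`. -/
theorem formQuot_eq_coord {x₀ x : M} (η : TwistedForm L) {s : ∀ x : M, L x}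
    (hx : x ∈ (trivializationAt ℂ L x₀).baseSet)
    (hx' : x ∈ (trivializationAt C2 (TangentSpace 𝓘(ℂ, C2)) x₀).baseSet) (hs : s x ≠ 0)
    (v : TangentSpace 𝓘(ℂ, C2) x) :
    formQuot η s x v = formCoord x₀ η x
      (trivializationAt C2 (TangentSpace 𝓘(ℂ, C2)) x₀ (TotalSpace.mk' C2 x v)).2 /
        sectionCoord x₀ s x := by
  rw [formCoord_apply η hx hx', eq_div_iff ((sectionCoord_ne_zero_iff hx).2 hs)]
  rw [← formQuot_smul η s x v hs, map_smul, smul_eq_mul]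
  rfl

/-- The fibre is a line and $s(x)\neq0$ spans it, so the coefficient is unique. -/
theorem formQuot_eq_of_smul {η : TwistedForm L} {s : ∀ x : M, L x} {x : M}
    {v : TangentSpace 𝓘(ℂ, C2) x} {a : ℂ} (hs : s x ≠ 0) (h : η x v = a • s x) :
    formQuot η s x v = a := by
  rw [← formQuot_smul η s x v hs] at h
  by_contra hne
  have h' : (formQuot η s x v - a) • s x = 0 := by rw [sub_smul, h, sub_self]
  have hx : x ∈ (trivializationAt ℂ L x).baseSet := FiberBundle.mem_baseSet_trivializationAt' x
  have h2 := congrArg ((trivializationAt ℂ L x).continuousLinearEquivAt ℂ x hx) h'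
  rw [map_smul, map_zero, smul_eq_mul, mul_eq_zero, sub_eq_zero] at h2
  rcases h2 with h2 | h2
  · exact hne h2
  · exact hs (((trivializationAt ℂ L x).continuousLinearEquivAt ℂ x hx).injective
      (by rw [h2, map_zero]))

/-- The points at which `f` and `s` are holomorphic and `s` has no zero. -/
def regularSet (s : ∀ x : M, L x) (D : Set M) : Set M := {x ∈ D | s x ≠ 0}

theorem contMDiffAt_sectionCoord {s : ∀ x : M, L x} {Ds : Set M}
    (hs : IsMeromorphicSection s Ds) {x₀ : M} (hx₀ : x₀ ∈ Ds) :
    ContMDiffAt 𝓘(ℂ, C2) 𝓘(ℂ, ℂ) ω (sectionCoord x₀ s) x₀ :=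
  (contMDiffAt_section x₀).1 (hs.holo.contMDiffAt (hs.isOpen.mem_nhds hx₀))

theorem isOpen_regularSet {s : ∀ x : M, L x} {Ds Df : Set M}
    (hs : IsMeromorphicSection s Ds) (hDf : IsOpen Df) : IsOpen (regularSet s (Ds ∩ Df)) := by
  rw [isOpen_iff_mem_nhds]
  rintro x ⟨hx, hsx⟩
  have hb : (trivializationAt ℂ L x).baseSet ∈ 𝓝 x :=
    (trivializationAt ℂ L x).open_baseSet.mem_nhds (FiberBundle.mem_baseSet_trivializationAt' x)
  have hc := (contMDiffAt_sectionCoord hs hx.1).continuousAt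
  have hne := hc.eventually_ne ((sectionCoord_ne_zero_iff (mem_of_mem_nhds hb)).2 hsx)
  filter_upwards [hb, hne, (hs.isOpen.inter hDf).mem_nhds hx] with y hy hy' hyD
  exact ⟨hyD, (sectionCoord_ne_zero_iff hy).1 hy'⟩

variable [∀ x, IsTopologicalAddGroup (L x)] [∀ x, ContinuousSMul ℂ (L x)]

open Classical in
/-- The difference quotient `(η ε - η 0) / ε`, completed by the coefficient `c` at `ε = 0`. -/
def slopeForm (η : ℂ → TwistedForm L) (c : TwistedForm L) (ε : ℂ) : TwistedForm L :=
  if ε = 0 then c else fun x => ε⁻¹ • (η ε x - η 0 x)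

theorem slopeForm_zero (η : ℂ → TwistedForm L) (c : TwistedForm L) : slopeForm η c 0 = c :=
  if_pos rfl

theorem slopeForm_of_ne (η : ℂ → TwistedForm L) (c : TwistedForm L) {ε : ℂ} (hε : ε ≠ 0) :
    slopeForm η c ε = fun x => ε⁻¹ • (η ε x - η 0 x) :=
  if_neg hε

theorem IsHolomorphicForm.contMDiffAt_formCoord {η : TwistedForm L} (hη : IsHolomorphicForm η)
    (x₀ : M) : ContMDiffAt 𝓘(ℂ, C2) 𝓘(ℂ, C2 →L[ℂ] ℂ) ω (formCoord x₀ η) x₀ :=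
  ((contMDiffAt_hom_bundle _).1 (hη x₀)).2

theorem eventually_mem_baseSets (x₀ : M) : ∀ᶠ x in 𝓝 x₀,
    x ∈ (trivializationAt ℂ L x₀).baseSet ∧
      x ∈ (trivializationAt C2 (TangentSpace 𝓘(ℂ, C2)) x₀).baseSet :=
  Filter.Eventually.and ((trivializationAt ℂ L x₀).open_baseSet.mem_nhds
      (FiberBundle.mem_baseSet_trivializationAt' x₀))
    ((trivializationAt C2 (TangentSpace 𝓘(ℂ, C2)) x₀).open_baseSet.mem_nhds
      (FiberBundle.mem_baseSet_trivializationAt' x₀))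

/-- The limit must be joint in the point and $\epsilon$, because the leaf paths move with
$\epsilon$. Convergence comes from joint holomorphy of the family; the power series, assumed only
pointwise, serves to identify the limit as `c 1`. -/
theorem tendsto_formCoord_slopeForm {η : ℂ → TwistedForm L} {c : ℕ → TwistedForm L}
    (hη : IsHolomorphicDeformation η c) (x₀ : M) :
    Tendsto (fun q : M × ℂ => formCoord x₀ (slopeForm η (c 1) q.2) q.1) (𝓝 (x₀, 0))
      (𝓝 (formCoord x₀ (c 1) x₀)) := by
  obtain ⟨hc, r, hr, hA, hsum⟩ := hη
  obtain ⟨hx₀, hx₀'⟩ := (eventually_mem_baseSets (L := L) x₀).self_of_nhds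
  set A : M × ℂ → C2 →L[ℂ] ℂ := fun q => formCoord x₀ (η q.2) q.1 with hAdef
  have hA' : ContMDiffAt (𝓘(ℂ, C2).prod 𝓘(ℂ, ℂ)) 𝓘(ℂ, C2 →L[ℂ] ℂ) ω A (x₀, 0) :=
    ((contMDiffAt_hom_bundle _).1 (hA.contMDiffAt
      (prod_mem_nhds univ_mem (Metric.ball_mem_nhds 0 hr)))).2
  have hdA : DifferentiableAt ℂ (fun ε => A (x₀, ε)) 0 := by
    have h1 : ContMDiffAt 𝓘(ℂ, ℂ) (𝓘(ℂ, C2).prod 𝓘(ℂ, ℂ)) ω (fun ε : ℂ => (x₀, ε)) 0 :=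
      contMDiffAt_const.prodMk contMDiffAt_id
    exact (hA'.comp (0 : ℂ) h1).contDiffAt.differentiableAt (by simp)
  have hd : HasDerivAt (fun ε => A (x₀, ε)) (formCoord x₀ (c 1) x₀) 0 := by
    suffices h : formCoord x₀ (c 1) x₀ = deriv (fun ε => A (x₀, ε)) 0 by
      rw [h]; exact hdA.hasDerivAt
    ext1 w
    have h1 : HasDerivAt (fun ε => A (x₀, ε) w) (deriv (fun ε => A (x₀, ε)) 0 w) 0 := by
      simpa using hdA.hasDerivAt.clm_apply (hasDerivAt_const (0 : ℂ) w)
    refine HasDerivAt.unique ?_ h1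
    simp only [hAdef, formCoord_eq _ hx₀ hx₀']
    set v := ((trivializationAt C2 (TangentSpace 𝓘(ℂ, C2)) x₀).continuousLinearEquivAt ℂ x₀
      hx₀').symm w
    set e := (trivializationAt ℂ L x₀).continuousLinearEquivAt ℂ x₀ hx₀
    refine hasDerivAt_of_hasSum_pow (a := fun i => e (c i x₀ v)) hr fun ε hε => ?_
    have := ((hsum ε hε).2 x₀ v).mapL (e : L x₀ →L[ℂ] ℂ)
    simpa using this
  -- A neighbourhood of $\epsilon=0$ is split into its punctured part, where genuine quotients
  -- occur, and the point $\epsilon=0$, where only continuity of `c 1` is needed.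
  rw [nhds_prod_eq, ← nhdsNE_sup_pure (0 : ℂ), prod_sup, tendsto_sup]
  have hb : ∀ᶠ q : M × ℂ in 𝓝 x₀ ×ˢ 𝓝[≠] 0, (q.1 ∈ (trivializationAt ℂ L x₀).baseSet ∧
      q.1 ∈ (trivializationAt C2 (TangentSpace 𝓘(ℂ, C2)) x₀).baseSet) ∧ q.2 ≠ 0 :=
    (tendsto_fst.eventually (eventually_mem_baseSets x₀)).and
      (tendsto_snd.eventually self_mem_nhdsWithin)
  constructor
  · refine (tendsto_slope_family hA' hd).congr' ?_
    filter_upwards [hb] with q hq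
    ext1 w
    rw [slopeForm_of_ne η (c 1) hq.2, formCoord_eq _ hq.1.1 hq.1.2]
    simp only [hAdef, smul_apply, sub_apply,
      formCoord_eq _ hq.1.1 hq.1.2, map_smul, map_sub]
  · rw [prod_pure, tendsto_map'_iff]
    simp only [Function.comp_def, slopeForm_zero]
    exact ((hc 1).contMDiffAt_formCoord x₀).continuousAt

end Quotients

/-! ### Continuity of the quotients on the tangent bundle -/

section Quotients

variable {M : Type*} [TopologicalSpace M] [ChartedSpace C2 M] [IsManifold 𝓘(ℂ, C2) ω M]
  {L : M → Type*} [TopologicalSpace (TotalSpace ℂ L)]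
  [∀ x, AddCommGroup (L x)] [∀ x, Module ℂ (L x)] [∀ x, TopologicalSpace (L x)]
  [FiberBundle ℂ L] [VectorBundle ℂ ℂ L]

variable [∀ x, IsTopologicalAddGroup (L x)] [∀ x, ContinuousSMul ℂ (L x)]

omit [∀ x, IsTopologicalAddGroup (L x)] [∀ x, ContinuousSMul ℂ (L x)] in
-- Point and vector form a single variable of the total space here, so that limits can be taken in
-- the tangent bundle.
theorem formQuot_eq_coord_tangentBundle {x₀ : M} (η : TwistedForm L) {s : ∀ x : M, L x}
    (v : TangentBundle 𝓘(ℂ, C2) M)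
    (hx : v.1 ∈ (trivializationAt ℂ L x₀).baseSet)
    (hx' : v.1 ∈ (trivializationAt C2 (TangentSpace 𝓘(ℂ, C2)) x₀).baseSet) (hs : s v.1 ≠ 0) :
    formQuot η s v.1 v.2 = formCoord x₀ η v.1
      (trivializationAt C2 (TangentSpace 𝓘(ℂ, C2)) x₀ v).2 / sectionCoord x₀ s v.1 :=
  formQuot_eq_coord η hx hx' hs v.2

/-- Joint continuity of the difference quotients of a deformation, divided by `s`. -/
theorem tendsto_formQuot_slopeForm {η : ℂ → TwistedForm L} {c : ℕ → TwistedForm L}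
    (hη : IsHolomorphicDeformation η c) {s : ∀ x : M, L x} {Ds : Set M}
    (hs : IsMeromorphicSection s Ds) {v₀ : TangentBundle 𝓘(ℂ, C2) M} (hx₀ : v₀.1 ∈ Ds)
    (hs₀ : s v₀.1 ≠ 0) :
    Tendsto (fun q : ℂ × TangentBundle 𝓘(ℂ, C2) M =>
      formQuot (slopeForm η (c 1) q.1) s q.2.1 q.2.2) (𝓝 0 ×ˢ 𝓝 v₀)
      (𝓝 (formQuot (c 1) s v₀.1 v₀.2)) := by
  obtain ⟨hb, hb'⟩ := (eventually_mem_baseSets (L := L) v₀.1).self_of_nhds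
  have hproj0 : Tendsto (fun v : TangentBundle 𝓘(ℂ, C2) M => v.1) (𝓝 v₀) (𝓝 v₀.1) :=
    (FiberBundle.continuous_proj C2 (TangentSpace 𝓘(ℂ, C2))).tendsto v₀
  have hcoord : ContinuousAt (sectionCoord v₀.1 s) v₀.1 :=
    (contMDiffAt_sectionCoord hs hx₀).continuousAt
  have hne : sectionCoord v₀.1 s v₀.1 ≠ 0 := (sectionCoord_ne_zero_iff hb).2 hs₀
  have htriv : Tendsto (fun v : TangentBundle 𝓘(ℂ, C2) M =>
      (trivializationAt C2 (TangentSpace 𝓘(ℂ, C2)) v₀.1 v).2) (𝓝 v₀)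
      (𝓝 (trivializationAt C2 (TangentSpace 𝓘(ℂ, C2)) v₀.1 v₀).2) := by
    have h1 : ContinuousAt (trivializationAt C2 (TangentSpace 𝓘(ℂ, C2)) v₀.1) v₀ :=
      (trivializationAt C2 (TangentSpace 𝓘(ℂ, C2)) v₀.1).continuousAt
        ((trivializationAt C2 (TangentSpace 𝓘(ℂ, C2)) v₀.1).mem_source.2 hb')
    exact (continuous_snd.tendsto _).comp h1.tendsto
  have hsnd : Tendsto (fun q : ℂ × TangentBundle 𝓘(ℂ, C2) M => q.2.1) (𝓝 0 ×ˢ 𝓝 v₀)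
      (𝓝 v₀.1) := hproj0.comp tendsto_snd
  have hpair : Tendsto (fun q : ℂ × TangentBundle 𝓘(ℂ, C2) M => (q.2.1, q.1)) (𝓝 0 ×ˢ 𝓝 v₀)
      (𝓝 (v₀.1, (0 : ℂ))) := hsnd.prodMk_nhds tendsto_fst
  have hform := (tendsto_formCoord_slopeForm hη v₀.1).comp hpair
  rw [formQuot_eq_coord_tangentBundle (x₀ := v₀.1) (c 1) v₀ hb hb' hs₀]
  have hev : ∀ᶠ q : ℂ × TangentBundle 𝓘(ℂ, C2) M in 𝓝 0 ×ˢ 𝓝 v₀,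
      (q.2.1 ∈ (trivializationAt ℂ L v₀.1).baseSet ∧
        q.2.1 ∈ (trivializationAt C2 (TangentSpace 𝓘(ℂ, C2)) v₀.1).baseSet) ∧
        sectionCoord v₀.1 s q.2.1 ≠ 0 :=
    tendsto_snd.eventually (hproj0.eventually
      ((eventually_mem_baseSets (L := L) v₀.1).and (hcoord.eventually_ne hne)))
  have happ := ((isBoundedBilinearMap_apply (𝕜 := ℂ) (E := C2) (F := ℂ)).continuous.tendsto
    (formCoord v₀.1 (c 1) v₀.1, (trivializationAt C2 (TangentSpace 𝓘(ℂ, C2)) v₀.1 v₀).2)).comp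
      (hform.prodMk_nhds (htriv.comp tendsto_snd))
  have hmain := happ.div
    ((hcoord.tendsto.comp hproj0).comp tendsto_snd) hne
  refine hmain.congr' ?_
  filter_upwards [hev] with q hq
  exact (formQuot_eq_coord_tangentBundle _ q.2 hq.1.1 hq.1.2
    ((sectionCoord_ne_zero_iff hq.1.1).1 hq.2)).symm

end Quotients

/-! ### Flow boxes of a submersion -/

/-- A nonzero linear form on `ℂ²` is the first coordinate of a linear isomorphism. -/
theorem exists_equiv_fst_eq {l : C2 →L[ℂ] ℂ} (hl : l ≠ 0) :
    ∃ (k : C2 →L[ℂ] ℂ) (e : C2 ≃L[ℂ] ℂ × ℂ), (e : C2 →L[ℂ] ℂ × ℂ) = l.prod k := by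
  obtain ⟨v, hv⟩ : ∃ v, l v ≠ 0 := by
    by_contra! h
    exact hl (ContinuousLinearMap.ext h)
  have hker : Module.finrank ℂ (LinearMap.ker (l : C2 →ₗ[ℂ] ℂ)) = 1 := by
    have h1 := LinearMap.finrank_range_add_finrank_ker (l : C2 →ₗ[ℂ] ℂ)
    have h2 : LinearMap.range (l : C2 →ₗ[ℂ] ℂ) = ⊤ :=
      LinearMap.range_eq_top.2 (LinearMap.surjective (fun h => hv (by
        simpa using congrArg (fun m : C2 →ₗ[ℂ] ℂ => m v) h)))
    rw [h2, finrank_top, Module.finrank_self, finrank_euclideanSpace_fin] at h1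
    omega
  obtain ⟨u, hu0, hu⟩ := finrank_eq_one_iff'.1 hker
  have hu0' : (u : C2) ≠ 0 := fun h => hu0 (Subtype.ext h)
  have hlu : l u = 0 := u.2
  -- The kernel of $l$ is the line spanned by $u$, so any $k$ with $k(u)\ne0$ makes $(l,k)$
  -- injective.
  obtain ⟨k, hk⟩ := SeparatingDual.exists_ne_zero (R := ℂ) hu0'
  have hinj : Function.Injective (l.prod k : C2 →ₗ[ℂ] ℂ × ℂ) := by
    rw [← LinearMap.ker_eq_bot, LinearMap.ker_eq_bot']
    intro z hz
    have hz1 : l z = 0 := congrArg Prod.fst hz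
    have hz2 : k z = 0 := congrArg Prod.snd hz
    obtain ⟨c, hc⟩ := hu ⟨z, hz1⟩
    have hc' : c • (u : C2) = z := congrArg Subtype.val hc
    rw [← hc', map_smul, smul_eq_mul, mul_eq_zero] at hz2
    rw [← hc', hz2.resolve_right hk, zero_smul]
  refine ⟨k, (LinearEquiv.ofInjectiveOfFinrankEq _ hinj (by simp)).toContinuousLinearEquiv, ?_⟩
  ext z <;> rfl

variable {M : Type*} [TopologicalSpace M] [ChartedSpace C2 M] [IsManifold 𝓘(ℂ, C2) ω M]

/-- `ψ` and `χ` are mutually inverse holomorphic coordinates, between the open set `V` and a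
bidisc, whose first coordinate is `f`. -/
structure IsFlowBox (f : M → ℂ) (ψ : ℂ × ℂ → M) (χ : M → ℂ × ℂ) (V : Set M) (p : ℂ × ℂ)
    (ρ : ℝ) : Prop where
  isOpen : IsOpen V
  mapsTo : ∀ x ∈ V, χ x ∈ Metric.ball p ρ
  mapsTo_symm : ∀ q ∈ Metric.ball p ρ, ψ q ∈ V
  left_inv : ∀ x ∈ V, ψ (χ x) = x
  right_inv : ∀ q ∈ Metric.ball p ρ, χ (ψ q) = q
  fst_eq : ∀ x ∈ V, (χ x).1 = f x
  contMDiffAt : ∀ x ∈ V, ContMDiffAt 𝓘(ℂ, C2) 𝓘(ℂ, ℂ × ℂ) ω χ x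
  contMDiffAt_symm : ∀ q ∈ Metric.ball p ρ, ContMDiffAt 𝓘(ℂ, ℂ × ℂ) 𝓘(ℂ, C2) ω ψ q

/-- Submersions have arbitrarily small flow boxes. -/
theorem exists_isFlowBox {f : M → ℂ} {x₀ : M} (hf : ContMDiffAt 𝓘(ℂ, C2) 𝓘(ℂ, ℂ) ω f x₀)
    {v : TangentSpace 𝓘(ℂ, C2) x₀} (hv : dif f x₀ v ≠ 0) {U : Set M} (hU : U ∈ 𝓝 x₀) :
    ∃ ψ χ V p ρ, x₀ ∈ V ∧ V ⊆ U ∧ IsFlowBox f ψ χ V p ρ := by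
  set φ := chartAt C2 x₀ with hφ
  have hx₀ : x₀ ∈ φ.source := mem_chart_source C2 x₀
  have hsymm : ContMDiffAt 𝓘(ℂ, C2) 𝓘(ℂ, C2) ω φ.symm (φ x₀) :=
    (contMDiffOn_chart_symm (x := x₀)).contMDiffAt
      (φ.open_target.mem_nhds (φ.map_source hx₀))
  set F : C2 → ℂ := fun z => f (φ.symm z) with hF
  have hinv : φ.symm (φ x₀) = x₀ := φ.left_inv hx₀
  have hFω : ContDiffAt ℂ ω F (φ x₀) :=
    (ContMDiffAt.comp (φ x₀) (by rwa [hinv]) hsymm).contDiffAt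
  have hdF : fderiv ℂ F (φ x₀) ≠ 0 := by
    intro h0
    apply hv
    have hmd : MDifferentiableAt 𝓘(ℂ, C2) 𝓘(ℂ, ℂ) f x₀ := hf.mdifferentiableAt (by simp)
    have h1 : HasFDerivWithinAt F (show C2 →L[ℂ] ℂ from mfderiv 𝓘(ℂ, C2) 𝓘(ℂ, ℂ) f x₀)
        (range 𝓘(ℂ, C2)) (φ x₀) := hmd.hasMFDerivAt.2
    rw [modelWithCornersSelf_coe, range_id, hasFDerivWithinAt_univ] at h1
    have h2 : (show C2 →L[ℂ] ℂ from mfderiv 𝓘(ℂ, C2) 𝓘(ℂ, ℂ) f x₀) = 0 := h1.fderiv ▸ h0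
    exact congrArg (fun m : C2 →L[ℂ] ℂ => m v) h2
  obtain ⟨k, e, he⟩ := exists_equiv_fst_eq hdF
  set Φ : C2 → ℂ × ℂ := fun z => (F z, k z) with hΦ
  have hΦω : ContDiffAt ℂ ω Φ (φ x₀) := hFω.prodMk k.contDiff.contDiffAt
  have hdΦ : HasFDerivAt Φ (e : C2 →L[ℂ] ℂ × ℂ) (φ x₀) := by
    rw [he]
    exact (hFω.differentiableAt (by simp)).hasFDerivAt.prodMk k.hasFDerivAt
  set T := φ.trans (hΦω.toOpenPartialHomeomorph Φ hdΦ (by simp)) with hT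
  have hxT : x₀ ∈ T.source := by
    rw [hT, OpenPartialHomeomorph.trans_source]
    exact ⟨hx₀, hΦω.mem_toOpenPartialHomeomorph_source hdΦ (by simp)⟩
  have hTinv : T.symm (T x₀) = x₀ := T.left_inv hxT
  have hTω : ContMDiffAt 𝓘(ℂ, C2) 𝓘(ℂ, ℂ × ℂ) ω T x₀ :=
    ContMDiffAt.comp x₀ (g := Φ) hΦω.contMDiffAt
      ((contMDiffOn_chart (x := x₀)).contMDiffAt (φ.open_source.mem_nhds hx₀))
  have hTsω : ContMDiffAt 𝓘(ℂ, ℂ × ℂ) 𝓘(ℂ, C2) ω T.symm (T x₀) := by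
    have h1 : ContDiffAt ℂ ω (hΦω.localInverse hdΦ (by simp)) (T x₀) :=
      hΦω.to_localInverse hdΦ (by simp)
    have h2 : hΦω.localInverse hdΦ (by simp) (T x₀) = φ x₀ :=
      hΦω.localInverse_apply_image hdΦ (by simp)
    have h3 : ContMDiffAt 𝓘(ℂ, C2) 𝓘(ℂ, C2) ω φ.symm
        (hΦω.localInverse hdΦ (by simp) (T x₀)) := by rwa [h2]
    exact ContMDiffAt.comp (T x₀) (g := φ.symm) (f := hΦω.localInverse hdΦ (by simp)) h3
      h1.contMDiffAt
  have hTc : Tendsto T.symm (𝓝 (T x₀)) (𝓝 x₀) := by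
    simpa [hTinv] using (T.continuousAt_symm (T.map_source hxT)).tendsto
  -- Analyticity at a point persists nearby, so all requirements hold on a small ball around the
  -- image of $x_0$. In the sup metric of $\mathbb C\times\mathbb C$ this ball is a bidisc.
  have hev : ∀ᶠ q in 𝓝 (T x₀), q ∈ T.target ∧ T.symm q ∈ U ∧
      ContMDiffAt 𝓘(ℂ, C2) 𝓘(ℂ, ℂ × ℂ) ω T (T.symm q) ∧
      ContMDiffAt 𝓘(ℂ, ℂ × ℂ) 𝓘(ℂ, C2) ω T.symm q := by
    filter_upwards [T.open_target.mem_nhds (T.map_source hxT), hTc.eventually hU,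
      hTc.eventually ((contMDiffAt_iff_contMDiffAt_nhds (by simp)).1 hTω),
      (contMDiffAt_iff_contMDiffAt_nhds (by simp)).1 hTsω] with q h1 h2 h3 h4
    exact ⟨h1, h2, h3, h4⟩
  obtain ⟨ρ, hρ, hball⟩ := Metric.eventually_nhds_iff_ball.1 hev
  have hV : ∀ x ∈ T.source ∩ T ⁻¹' Metric.ball (T x₀) ρ, T.symm (T x) = x :=
    fun x hx => T.left_inv hx.1
  refine ⟨T.symm, T, T.source ∩ T ⁻¹' Metric.ball (T x₀) ρ, T x₀, ρ,
    ⟨hxT, Metric.mem_ball_self hρ⟩, fun x hx => ?_, ?_⟩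
  · rw [← hV x hx]
    exact (hball _ hx.2).2.1
  · refine ⟨T.isOpen_inter_preimage Metric.isOpen_ball, fun x hx => hx.2, fun q hq => ?_, hV,
      fun q hq => T.right_inv (hball q hq).1, fun x hx => ?_, fun x hx => ?_,
      fun q hq => (hball q hq).2.2.2⟩
    · exact ⟨T.map_target (hball q hq).1, by simpa [T.right_inv (hball q hq).1] using hq⟩
    · have hxφ : x ∈ φ.source := by
        have := hx.1
        rw [hT, OpenPartialHomeomorph.trans_source] at this
        exact this.1
      change f (φ.symm (φ x)) = f x
      rw [φ.left_inv hxφ]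
    · rw [← hV x hx]
      exact (hball _ hx.2).2.2.1

/-! ### Primitives on plaques -/

section Primitives

variable {M : Type*} [TopologicalSpace M] [ChartedSpace C2 M] [IsManifold 𝓘(ℂ, C2) ω M]
  {L : M → Type*} [TopologicalSpace (TotalSpace ℂ L)]
  [∀ x, AddCommGroup (L x)] [∀ x, Module ℂ (L x)] [∀ x, TopologicalSpace (L x)]
  [FiberBundle ℂ L] [VectorBundle ℂ ℂ L]

theorem formQuot_smul_right (η : TwistedForm L) (s : ∀ x : M, L x) (x : M) (a : ℂ)
    (v : TangentSpace 𝓘(ℂ, C2) x) : formQuot η s x (a • v) = a * formQuot η s x v := by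
  have hx : x ∈ (trivializationAt ℂ L x).baseSet := FiberBundle.mem_baseSet_trivializationAt' x
  let A := (trivializationAt ℂ L x).continuousLinearEquivAt ℂ x hx
  have hA : ∀ y : L x, (trivializationAt ℂ L x (TotalSpace.mk' ℂ x y)).2 = A y := fun _ => rfl
  rw [formQuot, formQuot, hA, hA, hA, map_smul, map_smul, smul_eq_mul, mul_div_assoc]

/-- `G` is a primitive of the form `η / s` along the `C¹` paths contained in `S`. -/
def IsPathPrimitive (η : TwistedForm L) (s : ∀ x : M, L x) (S : Set M) (G : M → ℂ) : Prop :=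
  ∀ (γ : ℝ → M) (a b : ℝ), ContMDiffOn 𝓘(ℝ, ℝ) 𝓘(ℝ, C2) 1 γ (Icc 0 1) → 0 ≤ a → a ≤ b → b ≤ 1 →
    (∀ τ ∈ Icc a b, γ τ ∈ S) →
    IntervalIntegrable (fun τ => formQuot η s (γ τ) (velocity γ τ)) MeasureTheory.volume a b ∧
      ∫ τ in a..b, formQuot η s (γ τ) (velocity γ τ) = G (γ b) - G (γ a)

variable [∀ x, IsTopologicalAddGroup (L x)] [∀ x, ContinuousSMul ℂ (L x)]

/-- The coefficient of `η / s` along a holomorphic family of vectors is holomorphic. -/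
theorem differentiableAt_formQuot_mfderiv {η : TwistedForm L} (hη : IsHolomorphicForm η)
    {s : ∀ x : M, L x} {Ds : Set M} (hs : IsMeromorphicSection s Ds) {ψ : ℂ × ℂ → M} {q₀ : ℂ × ℂ}
    (hψ : ContMDiffAt 𝓘(ℂ, ℂ × ℂ) 𝓘(ℂ, C2) ω ψ q₀) (hx₀ : ψ q₀ ∈ Ds) (hs₀ : s (ψ q₀) ≠ 0)
    (w : ℂ × ℂ) :
    DifferentiableAt ℂ (fun q : ℂ × ℂ =>
      formQuot η s (ψ q) (mfderiv 𝓘(ℂ, ℂ × ℂ) 𝓘(ℂ, C2) ψ q w)) q₀ := by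
  obtain ⟨hb, hb'⟩ := (eventually_mem_baseSets (L := L) (ψ q₀)).self_of_nhds
  have hvec : ContMDiffAt 𝓘(ℂ, ℂ × ℂ) (𝓘(ℂ, C2).prod 𝓘(ℂ, C2)) 1 (fun q : ℂ × ℂ =>
      TotalSpace.mk' C2 (E := TangentSpace 𝓘(ℂ, C2)) (ψ q)
        (mfderiv 𝓘(ℂ, ℂ × ℂ) 𝓘(ℂ, C2) ψ q w)) q₀ := by
    have hϕ := hψ.mfderiv_const (m := 1) (by simp)
    refine ContMDiffAt.clm_apply_of_inCoordinates (F₁ := ℂ × ℂ) (IB₁ := 𝓘(ℂ, ℂ × ℂ))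
      (E₁ := TangentSpace 𝓘(ℂ, ℂ × ℂ)) (b₁ := id) (v := fun _ => w)
      (ϕ := fun q => mfderiv 𝓘(ℂ, ℂ × ℂ) 𝓘(ℂ, C2) ψ q) hϕ ?_ (hψ.of_le (by simp))
    exact (contMDiffAt_vectorSpace_iff_contDiffAt (𝕜 := ℂ) (V := fun _ => w)).2 contDiffAt_const
  have hv := (contMDiffAt_totalSpace.1 hvec).2.contDiffAt.differentiableAt one_ne_zero
  have hf : DifferentiableAt ℂ (fun q => formCoord (ψ q₀) η (ψ q)) q₀ :=
    ((hη.contMDiffAt_formCoord (ψ q₀)).comp q₀ hψ).contDiffAt.differentiableAt (by simp)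
  have hsec : DifferentiableAt ℂ (fun q => sectionCoord (ψ q₀) s (ψ q)) q₀ :=
    ((contMDiffAt_sectionCoord hs hx₀).comp q₀ hψ).contDiffAt.differentiableAt (by simp)
  have hne : sectionCoord (ψ q₀) s (ψ q₀) ≠ 0 := (sectionCoord_ne_zero_iff hb).2 hs₀
  refine ((hf.clm_apply hv).mul (hsec.inv hne)).congr_of_eventuallyEq ?_
  filter_upwards [hψ.continuousAt.eventually (eventually_mem_baseSets (L := L) (ψ q₀)),
    hsec.continuousAt.eventually_ne hne] with q hq hq'
  exact (formQuot_eq_coord η hq.1 hq.2 ((sectionCoord_ne_zero_iff hq.1).1 hq') _).trans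
    (div_eq_mul_inv _ _)

/-- In a flow box, the restriction of `η / s` to a plaque has a primitive. -/
theorem IsFlowBox.exists_isPathPrimitive {f : M → ℂ} {ψ : ℂ × ℂ → M} {χ : M → ℂ × ℂ} {V : Set M}
    {p : ℂ × ℂ} {ρ : ℝ} (hbox : IsFlowBox f ψ χ V p ρ) {η : TwistedForm L}
    (hη : IsHolomorphicForm η) {s : ∀ x : M, L x} {Ds : Set M} (hs : IsMeromorphicSection s Ds)
    (hVD : V ⊆ Ds) (hV0 : ∀ x ∈ V, s x ≠ 0) (w : ℂ) :
    ∃ G : M → ℂ, IsPathPrimitive η s (V ∩ f ⁻¹' {w}) G := by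
  by_cases hw : w ∈ Metric.ball p.1 ρ
  swap
  -- The level does not meet the box, so no path lies in this plaque and any function serves.
  · refine ⟨0, fun γ a b _ _ hab _ hS => (hw ?_).elim⟩
    obtain ⟨hV, hfw⟩ := hS a (left_mem_Icc.2 hab)
    have h1 := hbox.mapsTo _ hV
    rw [← Prod.mk.eta (p := p), ← ball_prod_same] at h1
    have h2 := h1.1
    rwa [hbox.fst_eq _ hV, show f (γ a) = w from hfw] at h2
  have hball : ∀ y ∈ Metric.ball p.2 ρ, (w, y) ∈ Metric.ball p ρ := fun y hy => by
    rw [← Prod.mk.eta (p := p), ← ball_prod_same]; exact ⟨hw, hy⟩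
  -- $\alpha\,dy$ is the pullback of $\eta/s$ to the slice $\{w\}\times$ disc; it is holomorphic, so
  -- $\alpha$ has a primitive $g$ on the disc.
  set α : ℂ → ℂ := fun y =>
    formQuot η s (ψ (w, y)) (mfderiv 𝓘(ℂ, ℂ × ℂ) 𝓘(ℂ, C2) ψ (w, y) ((0, 1) : ℂ × ℂ)) with hα
  have hαd : DifferentiableOn ℂ α (Metric.ball p.2 ρ) := by
    intro y hy
    have hq := hball y hy
    have hV := hbox.mapsTo_symm _ hq
    have h1 := differentiableAt_formQuot_mfderiv hη hs (hbox.contMDiffAt_symm _ hq) (hVD hV)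
      (hV0 _ hV) ((0, 1) : ℂ × ℂ)
    have h2 : DifferentiableAt ℂ (fun y : ℂ => (w, y)) y := by fun_prop
    exact (h1.comp y h2).differentiableWithinAt
  obtain ⟨g, hg⟩ := hαd.isExactOn_ball
  refine ⟨fun x => g (χ x).2, fun γ a b hγ ha hab hb hS => ?_⟩
  have hsub : Icc a b ⊆ Icc (0 : ℝ) 1 := Icc_subset_Icc ha hb
  set u : ℝ → ℂ × ℂ := fun τ => χ (γ τ) with hu
  have huc : ContDiffOn ℝ 1 u (Icc a b) := fun τ hτ =>
    (contDiffWithinAt_comp_path (hγ τ (hsub hτ))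
      ((hbox.contMDiffAt _ (hS τ hτ).1).of_le (by simp))).mono hsub
  have hu1 : ∀ τ ∈ Icc a b, (u τ).1 = w := fun τ hτ => by
    rw [hu, hbox.fst_eq _ (hS τ hτ).1]; exact (hS τ hτ).2
  have hu2 : ∀ τ ∈ Icc a b, (u τ).2 ∈ Metric.ball p.2 ρ := fun τ hτ => by
    have h1 := hbox.mapsTo _ (hS τ hτ).1
    rw [← Prod.mk.eta (p := p), ← ball_prod_same] at h1
    exact h1.2
  have hueq : ∀ τ ∈ Icc a b, u τ = (w, (u τ).2) := fun τ hτ => Prod.ext (hu1 τ hτ) rfl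
  -- As $f\circ\gamma$ is constant, the velocity in the box has only a $y$-component $y'$, whence
  -- $(\eta/s)(\gamma')=\alpha y'$. Interior times suffice for the integrals and allow two-sided
  -- derivatives.
  have key : ∀ τ ∈ Ioo a b, ∃ y' : ℂ, HasDerivAt (fun τ => (u τ).2) y' τ ∧
      formQuot η s (γ τ) (velocity γ τ) = α (u τ).2 * y' := by
    intro τ hτ
    have hτ' := Ioo_subset_Icc_self hτ
    have hxV := (hS τ hτ').1
    have hq := hbox.mapsTo _ hxV
    have hχ : MDifferentiableAt 𝓘(ℂ, C2) 𝓘(ℂ, ℂ × ℂ) χ (γ τ) :=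
      (hbox.contMDiffAt _ hxV).mdifferentiableAt (by simp)
    have hψ : MDifferentiableAt 𝓘(ℂ, ℂ × ℂ) 𝓘(ℂ, C2) ψ (χ (γ τ)) :=
      (hbox.contMDiffAt_symm _ hq).mdifferentiableAt (by simp)
    have hd := (hasDerivWithinAt_comp_path (hγ τ (hsub hτ')) hχ).hasDerivAt
      (Icc_mem_nhds (ha.trans_lt hτ.1) (hτ.2.trans_le hb))
    set d : ℂ × ℂ := mfderiv 𝓘(ℂ, C2) 𝓘(ℂ, ℂ × ℂ) χ (γ τ) (velocity γ τ) with hddef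
    have hd1 : d.1 = 0 := by
      have h1 : HasDerivAt (fun τ => (u τ).1) d.1 τ := hd.fst
      refine h1.unique ((hasDerivAt_const τ w).congr_of_eventuallyEq ?_)
      filter_upwards [Icc_mem_nhds hτ.1 hτ.2] with τ' hτ'' using hu1 τ' hτ''
    refine ⟨d.2, hd.snd, ?_⟩
    have hcomp : mfderiv 𝓘(ℂ, ℂ × ℂ) 𝓘(ℂ, C2) ψ (χ (γ τ)) d = velocity γ τ := by
      have h1 := hψ.hasMFDerivAt.comp (γ τ) hχ.hasMFDerivAt
      have h2 : HasMFDerivAt 𝓘(ℂ, C2) 𝓘(ℂ, C2) (ψ ∘ χ) (γ τ)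
          (ContinuousLinearMap.id ℂ (TangentSpace 𝓘(ℂ, C2) (γ τ))) := by
        refine (hasMFDerivAt_id (γ τ)).congr_of_eventuallyEq ?_
        filter_upwards [hbox.isOpen.mem_nhds hxV] with x hx using hbox.left_inv x hx
      have h3 := hasMFDerivAt_unique h1 h2
      exact congrArg (fun m : C2 →L[ℂ] C2 => m (velocity γ τ)) h3
    have hdsmul : d = d.2 • ((0, 1) : ℂ × ℂ) := Prod.ext (by simp [hd1]) (by simp)
    -- The type of the vector depends on the base point, so both are replaced together.
    have hcongr : ∀ (x x' : M) (v v' : C2), x = x' → v = v' →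
        formQuot η s x v = formQuot η s x' v' := by
      rintro _ _ _ _ rfl rfl; rfl
    have hlin : mfderiv 𝓘(ℂ, ℂ × ℂ) 𝓘(ℂ, C2) ψ (χ (γ τ)) d =
        d.2 • mfderiv 𝓘(ℂ, ℂ × ℂ) 𝓘(ℂ, C2) ψ (χ (γ τ)) ((0, 1) : ℂ × ℂ) := by
      conv_lhs => rw [hdsmul]
      exact map_smul (show ℂ × ℂ →L[ℂ] C2 from mfderiv 𝓘(ℂ, ℂ × ℂ) 𝓘(ℂ, C2) ψ (χ (γ τ))) d.2 _
    calc formQuot η s (γ τ) (velocity γ τ)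
        = formQuot η s (ψ (χ (γ τ))) (d.2 • mfderiv 𝓘(ℂ, ℂ × ℂ) 𝓘(ℂ, C2) ψ (χ (γ τ))
            ((0, 1) : ℂ × ℂ)) :=
          hcongr _ _ _ _ (hbox.left_inv _ hxV).symm (hcomp.symm.trans hlin)
      _ = α (u τ).2 * d.2 := by
          have hαu : α (u τ).2 = formQuot η s (ψ (u τ))
              (mfderiv 𝓘(ℂ, ℂ × ℂ) 𝓘(ℂ, C2) ψ (u τ) ((0, 1) : ℂ × ℂ)) := by
            rw [hα]
            beta_reduce
            rw [← hueq τ hτ']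
          rw [formQuot_smul_right, mul_comm, hαu]
  rcases hab.eq_or_lt with rfl | hlt
  · simp
  have hy : ContDiffOn ℝ 1 (fun τ => (u τ).2) (Icc a b) := huc.snd
  have hcont : ContinuousOn (fun τ => α (u τ).2 * derivWithin (fun τ => (u τ).2) (Icc a b) τ)
      (Icc a b) :=
    (hαd.continuousOn.comp hy.continuousOn hu2).mul
      (hy.continuousOn_derivWithin (uniqueDiffOn_Icc hlt) le_rfl)
  have hint : IntervalIntegrable (fun τ => formQuot η s (γ τ) (velocity γ τ))
      MeasureTheory.volume a b := by
    rw [intervalIntegrable_iff_integrableOn_Ioo_of_le hab]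
    refine ((hcont.integrableOn_Icc).mono_set Ioo_subset_Icc_self).congr_fun (fun τ hτ => ?_)
      measurableSet_Ioo
    obtain ⟨y', hy', he⟩ := key τ hτ
    beta_reduce
    rw [he, hy'.hasDerivWithinAt.derivWithin
      (uniqueDiffOn_Icc hlt τ (Ioo_subset_Icc_self hτ))]
  refine ⟨hint, intervalIntegral.integral_eq_sub_of_hasDerivAt_of_le hab
    (f := fun τ => g (u τ).2) (fun τ hτ => ?_) (fun τ hτ => ?_) hint⟩
  · exact ContinuousWithinAt.comp (t := univ)
      (hg _ (hu2 τ hτ)).continuousAt.continuousWithinAt (hy.continuousOn τ hτ) (mapsTo_univ _ _)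
  · obtain ⟨y', hy', he⟩ := key τ hτ
    rw [he]
    exact (hg _ (hu2 τ (Ioo_subset_Icc_self hτ))).comp τ hy'

omit [FiberBundle ℂ L] [VectorBundle ℂ ℂ L] [∀ x, IsTopologicalAddGroup (L x)]
  [∀ x, ContinuousSMul ℂ (L x)] [TopologicalSpace (TotalSpace ℂ L)] [∀ x, AddCommGroup (L x)]
  [∀ x, Module ℂ (L x)] [∀ x, TopologicalSpace (L x)] in
/-- In a flow box, the plaques are path connected. -/
theorem IsFlowBox.exists_path {f : M → ℂ} {ψ : ℂ × ℂ → M} {χ : M → ℂ × ℂ} {V : Set M}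
    {p : ℂ × ℂ} {ρ : ℝ} (hbox : IsFlowBox f ψ χ V p ρ) {x y : M} (hx : x ∈ V) (hy : y ∈ V)
    (hxy : f x = f y) : ∃ κ : ℝ → M, ContMDiffOn 𝓘(ℝ, ℝ) 𝓘(ℝ, C2) 1 κ (Icc 0 1) ∧ κ 0 = x ∧
      κ 1 = y ∧ ∀ τ ∈ Icc (0 : ℝ) 1, κ τ ∈ V ∩ f ⁻¹' {f x} := by
  -- The segment in the convex bidisc keeps its first coordinate, the value of $f$, constant.
  set l : ℝ → ℂ × ℂ := fun τ => χ x + τ • (χ y - χ x) with hl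
  have hlb : ∀ τ ∈ Icc (0 : ℝ) 1, l τ ∈ Metric.ball p ρ := fun τ hτ =>
    (convex_ball p ρ).add_smul_sub_mem (hbox.mapsTo x hx) (hbox.mapsTo y hy) hτ
  refine ⟨fun τ => ψ (l τ), fun τ hτ => ?_, ?_, ?_, fun τ hτ => ?_⟩
  · have h1 : ContMDiffAt 𝓘(ℝ, ℂ × ℂ) 𝓘(ℝ, C2) 1 ψ (l τ) :=
      contMDiffAt_restrictScalars ((hbox.contMDiffAt_symm _ (hlb τ hτ)).of_le (by simp))
    have h2 : ContDiff ℝ 1 l := by fun_prop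
    exact (ContMDiffAt.comp τ h1 h2.contDiffAt.contMDiffAt).contMDiffWithinAt
  · simp [hl, hbox.left_inv x hx]
  · simp [hl, hbox.left_inv y hy]
  · have hV := hbox.mapsTo_symm _ (hlb τ hτ)
    refine ⟨hV, ?_⟩
    have h1 : (χ y).1 = (χ x).1 := by rw [hbox.fst_eq x hx, hbox.fst_eq y hy, hxy]
    rw [mem_preimage, mem_singleton_iff, ← hbox.fst_eq _ hV, hbox.right_inv _ (hlb τ hτ),
      ← hbox.fst_eq x hx]
    simp [hl, h1]

/-- Two primitives on a plaque differ by a constant. -/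
theorem IsPathPrimitive.sub_eq_sub {η : TwistedForm L} {s : ∀ x : M, L x} {S S' : Set M}
    {G G' : M → ℂ} (hG : IsPathPrimitive η s S G) (hG' : IsPathPrimitive η s S' G') {κ : ℝ → M}
    (hκ : ContMDiffOn 𝓘(ℝ, ℝ) 𝓘(ℝ, C2) 1 κ (Icc 0 1))
    (hS : ∀ τ ∈ Icc (0 : ℝ) 1, κ τ ∈ S ∩ S') : G (κ 1) - G (κ 0) = G' (κ 1) - G' (κ 0) := by
  rw [← (hG κ 0 1 hκ le_rfl zero_le_one le_rfl fun τ hτ => (hS τ hτ).1).2,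
    ← (hG' κ 0 1 hκ le_rfl zero_le_one le_rfl fun τ hτ => (hS τ hτ).2).2]

end Primitives

/-! ### Invariance of integrals under small deformation in a leaf -/

section Homotopy

variable {M : Type*} [TopologicalSpace M] [ChartedSpace C2 M] [IsManifold 𝓘(ℂ, C2) ω M]
  {L : M → Type*} [TopologicalSpace (TotalSpace ℂ L)]
  [∀ x, AddCommGroup (L x)] [∀ x, Module ℂ (L x)] [∀ x, TopologicalSpace (L x)]
  [FiberBundle ℂ L] [VectorBundle ℂ ℂ L]

variable [∀ x, IsTopologicalAddGroup (L x)] [∀ x, ContinuousSMul ℂ (L x)]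

/-- Along `Γ t` and `Δ t`, the integrals of `η / s` over `[0, τ]` differ, for `t` along `l`, by the
increment of any primitive of `η / s` on the local plaque. -/
def IntegralsAgree {ι : Type*} (l : Filter ι) (η : TwistedForm L) (s : ∀ x : M, L x) (f : M → ℂ)
    (w : ι → ℂ) (δ : ℝ → M) (Γ Δ : ι → ℝ → M) (τ : ℝ) : Prop :=
  ∀ U ∈ 𝓝 (δ τ), ∀ᶠ t in l,
    IntervalIntegrable (fun u => formQuot η s (Γ t u) (velocity (Γ t) u))
      MeasureTheory.volume 0 τ ∧
    IntervalIntegrable (fun u => formQuot η s (Δ t u) (velocity (Δ t) u))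
      MeasureTheory.volume 0 τ ∧
    ∀ G, IsPathPrimitive η s (U ∩ f ⁻¹' {w t}) G →
      (∫ u in (0 : ℝ)..τ, formQuot η s (Γ t u) (velocity (Γ t) u)) -
        ∫ u in (0 : ℝ)..τ, formQuot η s (Δ t u) (velocity (Δ t) u) = G (Γ t τ) - G (Δ t τ)

/-- The integrals of `η / s` along paths in the leaves of `df = 0` which are close to each other
and have the same end points are equal. -/
theorem eventually_integral_eq {ι : Type*} {l : Filter ι} {η : TwistedForm L}
    (hη : IsHolomorphicForm η) {s : ∀ x : M, L x} {Ds Df : Set M}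
    (hs : IsMeromorphicSection s Ds) {f : M → ℂ} (hf : IsMeromorphicFunction f Df) {δ : ℝ → M}
    (hδ : ContinuousOn δ (Icc 0 1))
    (hδ_reg : ∀ τ ∈ Icc (0 : ℝ) 1, δ τ ∈ regularSet s (Ds ∩ Df))
    (hδ_df : ∀ τ ∈ Icc (0 : ℝ) 1, ∃ v, dif f (δ τ) v ≠ 0) {w : ι → ℂ} {Γ Δ : ι → ℝ → M}
    (hΓΔ : ∀ᶠ t in l, ContMDiffOn 𝓘(ℝ, ℝ) 𝓘(ℝ, C2) 1 (Γ t) (Icc 0 1) ∧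
      ContMDiffOn 𝓘(ℝ, ℝ) 𝓘(ℝ, C2) 1 (Δ t) (Icc 0 1) ∧
      (∀ τ ∈ Icc (0 : ℝ) 1, f (Γ t τ) = w t ∧ f (Δ t τ) = w t) ∧
      Γ t 0 = Δ t 0 ∧ Γ t 1 = Δ t 1)
    (hclose : ∀ a b : ℝ, 0 ≤ a → b ≤ 1 → ∀ U : Set M, IsOpen U → (∀ τ ∈ Icc a b, δ τ ∈ U) →
      ∀ᶠ t in l, ∀ τ ∈ Icc a b, Γ t τ ∈ U ∧ Δ t τ ∈ U) :
    ∀ᶠ t in l,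
      IntervalIntegrable (fun u => formQuot η s (Δ t u) (velocity (Δ t) u))
        MeasureTheory.volume 0 1 ∧
      ∫ u in (0 : ℝ)..1, formQuot η s (Γ t u) (velocity (Γ t) u) =
        ∫ u in (0 : ℝ)..1, formQuot η s (Δ t u) (velocity (Δ t) u) := by
  have hbox : ∀ τ ∈ Icc (0 : ℝ) 1, ∀ U ∈ 𝓝 (δ τ), ∃ ψ χ V p ρ, δ τ ∈ V ∧ V ⊆ U ∧
      V ⊆ regularSet s (Ds ∩ Df) ∧ IsFlowBox f ψ χ V p ρ := by
    intro τ hτ U hU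
    obtain ⟨v, hv⟩ := hδ_df τ hτ
    have hfω : ContMDiffAt 𝓘(ℂ, C2) 𝓘(ℂ, ℂ) ω f (δ τ) :=
      hf.holo.contMDiffAt (hf.isOpen.mem_nhds (hδ_reg τ hτ).1.2)
    obtain ⟨ψ, χ, V, p, ρ, h1, h2, h3⟩ := exists_isFlowBox hfω hv
      (inter_mem hU ((isOpen_regularSet hs hf.isOpen).mem_nhds (hδ_reg τ hτ)))
    exact ⟨ψ, χ, V, p, ρ, h1, h2.trans inter_subset_left, h2.trans inter_subset_right, h3⟩
  have hprim : ∀ {ψ χ V p ρ}, IsFlowBox f ψ χ V p ρ → V ⊆ regularSet s (Ds ∩ Df) → ∀ w : ℂ,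
      ∃ G : M → ℂ, IsPathPrimitive η s (V ∩ f ⁻¹' {w}) G := fun hb hV w =>
    hb.exists_isPathPrimitive hη hs (fun x hx => (hV hx).1.1) (fun x hx => (hV hx).2) w
  have hzero : IntegralsAgree l η s f w δ Γ Δ 0 := by
    intro U hU
    filter_upwards [hΓΔ] with t ht
    simp [ht.2.2.2.1]
  -- Over $[a,b]$ both paths stay in the plaque of $V$ with primitive $G$. The increments of $G$
  -- added to the two integrals telescope with the difference already known at $a$.
  have hstep : ∀ a b : ℝ, 0 ≤ a → a ≤ b → b ≤ 1 → ∀ {ψ χ V p ρ}, IsFlowBox f ψ χ V p ρ →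
      V ⊆ regularSet s (Ds ∩ Df) → (∀ τ ∈ Icc a b, δ τ ∈ V) →
      IntegralsAgree l η s f w δ Γ Δ a → IntegralsAgree l η s f w δ Γ Δ b := by
    intro a b ha hab hb ψ χ V p ρ hV hVR hδV hA U hU
    have hbV : V ∈ 𝓝 (δ b) := hV.isOpen.mem_nhds (hδV b (right_mem_Icc.2 hab))
    -- The plaque of $U\cap V$ may be disconnected. A smaller box $V'$ inside it has a connected
    -- plaque containing both points at time $b$, and this allows passing from $G$ to any primitive
    -- $G'$ on $U$.
    obtain ⟨ψ', χ', V', p', ρ', hbV', hV'U, hV'R, hV'⟩ :=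
      hbox b ⟨ha.trans hab, hb⟩ (U ∩ V) (inter_mem hU hbV)
    filter_upwards [hΓΔ, hA V (hV.isOpen.mem_nhds (hδV a (left_mem_Icc.2 hab))),
      hclose a b ha hb V hV.isOpen hδV,
      hclose b b (ha.trans hab) hb V' hV'.isOpen (by simpa using hbV')] with t h1 h2 h3 h4
    obtain ⟨hcΓ, hcΔ, hlev, -, -⟩ := h1
    obtain ⟨hiΓ, hiΔ, hI⟩ := h2
    obtain ⟨hbΓ, hbΔ⟩ := h4 b (left_mem_Icc.2 le_rfl)
    obtain ⟨G, hG⟩ := hprim hV hVR (w t)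
    have hsub : ∀ τ ∈ Icc a b, τ ∈ Icc (0 : ℝ) 1 := fun τ hτ => ⟨ha.trans hτ.1, hτ.2.trans hb⟩
    obtain ⟨hjΓ, heΓ⟩ := hG (Γ t) a b hcΓ ha hab hb
      fun τ hτ => ⟨(h3 τ hτ).1, (hlev τ (hsub τ hτ)).1⟩
    obtain ⟨hjΔ, heΔ⟩ := hG (Δ t) a b hcΔ ha hab hb
      fun τ hτ => ⟨(h3 τ hτ).2, (hlev τ (hsub τ hτ)).2⟩
    refine ⟨hiΓ.trans hjΓ, hiΔ.trans hjΔ, fun G' hG' => ?_⟩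
    have hlb := hlev b (hsub b (right_mem_Icc.2 hab))
    obtain ⟨κ, hκ, hκ0, hκ1, hκV⟩ := hV'.exists_path hbΔ hbΓ (hlb.2.trans hlb.1.symm)
    have hdiff := hG.sub_eq_sub hG' hκ fun τ hτ => by
      obtain ⟨h5, h6⟩ := hκV τ hτ
      have h7 : f (κ τ) = w t := (show f (κ τ) = _ from h6).trans hlb.2
      exact ⟨⟨(hV'U h5).2, h7⟩, ⟨(hV'U h5).1, h7⟩⟩
    rw [hκ0, hκ1] at hdiff
    rw [← intervalIntegral.integral_add_adjacent_intervals hiΓ hjΓ,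
      ← intervalIntegral.integral_add_adjacent_intervals hiΔ hjΔ, heΓ, heΔ, ← hdiff]
    linear_combination hI G hG
  have hone : IntegralsAgree l η s f w δ Γ Δ 1 := by
    have hb : ∀ τ : Icc (0 : ℝ) 1, ∃ ψ χ V p ρ, δ τ ∈ V ∧ V ⊆ regularSet s (Ds ∩ Df) ∧
        IsFlowBox f ψ χ V p ρ := fun τ => by
      obtain ⟨ψ, χ, V, p, ρ, h1, -, h3, h4⟩ := hbox τ τ.2 univ univ_mem
      exact ⟨ψ, χ, V, p, ρ, h1, h3, h4⟩
    choose ψ χ V p ρ hmem hreg hflow using hb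
    -- By compactness, $[0,1]$ is subdivided into finitely many intervals, each sent by $\delta$
    -- into one flow box.
    obtain ⟨T, hT0, hmono, ⟨m, hm⟩, hcov⟩ := exists_monotone_Icc_subset_open_cover_Icc
      (zero_le_one (α := ℝ)) (c := fun τ : Icc (0 : ℝ) 1 => {u : Icc (0 : ℝ) 1 | δ u ∈ V τ})
      (fun τ => (hflow τ).isOpen.preimage (continuousOn_iff_continuous_domRestrict.1 hδ))
      (fun τ _ => mem_iUnion.2 ⟨τ, hmem τ⟩)
    have hall : ∀ n, IntegralsAgree l η s f w δ Γ Δ (T n) := by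
      intro n
      induction n with
      | zero => rw [hT0]; exact hzero
      | succ n ih =>
        obtain ⟨i, hi⟩ := hcov n
        refine hstep (T n) (T (n + 1)) (T n).2.1 (hmono n.le_succ) (T (n + 1)).2.2 (hflow i)
          (hreg i) (fun τ hτ => ?_) ih
        exact hi (show (⟨τ, (T n).2.1.trans hτ.1, hτ.2.trans (T (n + 1)).2.2⟩ : Icc (0 : ℝ) 1) ∈
          Icc (T n) (T (n + 1)) from hτ)
    have := hall m
    rwa [hm m le_rfl] at this
  obtain ⟨ψ, χ, V, p, ρ, h1, -, h3, h4⟩ := hbox 1 (right_mem_Icc.2 zero_le_one) univ univ_mem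
  filter_upwards [hΓΔ, hone V (h4.isOpen.mem_nhds h1)] with t ht ht'
  obtain ⟨G, hG⟩ := hprim h4 h3 (w t)
  refine ⟨ht'.2.1, sub_eq_zero.1 ?_⟩
  rw [ht'.2.2 G hG, ht.2.2.2.2, sub_self]

end Homotopy

/-! ### The derivative of the holonomy -/

section Melnikov

/-- Convergence of the integrals over `[0, 1]` of a family that is continuous at parameter `0`. -/
theorem tendsto_integral_of_tendsto_prod {g : ℂ → ℝ → ℂ}
    (hg : ∀ τ ∈ Icc (0 : ℝ) 1,
      Tendsto (fun z : ℂ × ℝ => g z.1 z.2) (𝓝 0 ×ˢ 𝓝[Icc 0 1] τ) (𝓝 (g 0 τ)))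
    (hi : ∀ᶠ ε in 𝓝[≠] (0 : ℂ), IntervalIntegrable (g ε) MeasureTheory.volume 0 1) :
    Tendsto (fun ε => ∫ τ in (0 : ℝ)..1, g ε τ) (𝓝[≠] 0) (𝓝 (∫ τ in (0 : ℝ)..1, g 0 τ)) := by
  have hcont : ContinuousOn (g 0) (Icc 0 1) := fun τ hτ =>
    (hg τ hτ).comp (tendsto_const_nhds.prodMk tendsto_id)
  have hi0 : IntervalIntegrable (g 0) MeasureTheory.volume 0 1 :=
    ContinuousOn.intervalIntegrable (by rwa [uIcc_of_le zero_le_one])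
  rw [Metric.tendsto_nhds]
  intro r hr
  -- Compactness of $[0,1]$ turns joint continuity into uniform convergence. The repeated membership
  -- makes the claim vacuous for times outside $[0,1]$, so that full neighbourhoods can be used.
  have hunif : ∀ᶠ ε in 𝓝 (0 : ℂ), ∀ τ ∈ Icc (0 : ℝ) 1,
      τ ∈ Icc (0 : ℝ) 1 → ‖g ε τ - g 0 τ‖ < r / 2 := by
    refine isCompact_Icc.eventually_forall_of_forall_eventually fun τ hτ => ?_
    have h1 : Tendsto (fun z : ℂ × ℝ => ‖g z.1 z.2 - g 0 z.2‖) (𝓝 0 ×ˢ 𝓝[Icc 0 1] τ) (𝓝 0) := by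
      have h2 := ((hg τ hτ).sub ((hcont τ hτ).tendsto.comp
        (tendsto_snd (f := 𝓝 (0 : ℂ)) (g := 𝓝[Icc 0 1] τ)))).norm
      simpa using h2
    have h3 := h1.eventually (gt_mem_nhds (half_pos hr))
    have h4 : 𝓝 (0 : ℂ) ×ˢ 𝓝[Icc 0 1] τ = 𝓝[univ ×ˢ Icc 0 1] (0, τ) := by
      rw [nhdsWithin_prod_eq, nhdsWithin_univ]
    rw [h4, eventually_nhdsWithin_iff] at h3
    filter_upwards [h3] with z hz hz' using hz ⟨mem_univ _, hz'⟩
  filter_upwards [hi, nhdsWithin_le_nhds hunif] with ε hε hε'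
  rw [dist_eq_norm, ← intervalIntegral.integral_sub hε hi0]
  have := intervalIntegral.norm_integral_le_of_norm_le_const (a := (0 : ℝ)) (b := 1)
    (C := r / 2) (f := fun τ => g ε τ - g 0 τ) fun τ hτ => by
      rw [uIoc_of_le zero_le_one] at hτ
      exact (hε' τ (Ioc_subset_Icc_self hτ) (Ioc_subset_Icc_self hτ)).le
  simp only [sub_zero, abs_one, mul_one] at this
  linarith

variable {M : Type*} [TopologicalSpace M]

/-- A continuous family of paths stays close to its central member. -/
theorem eventually_forall_mem_of_continuousOn {P : Type*} [TopologicalSpace P] {p₀ : P} {N : Set P}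
    (hN : N ∈ 𝓝 p₀) {Γ : P → ℝ → M} {δ : ℝ → M}
    (hΓ : ContinuousOn (fun q : P × ℝ => Γ q.1 q.2) (N ×ˢ Icc 0 1))
    (h0 : ∀ τ ∈ Icc (0 : ℝ) 1, Γ p₀ τ = δ τ) {a b : ℝ} (ha : 0 ≤ a) (hb : b ≤ 1) {U : Set M}
    (hU : IsOpen U) (hδ : ∀ τ ∈ Icc a b, δ τ ∈ U) :
    ∀ᶠ p in 𝓝 p₀, ∀ τ ∈ Icc a b, Γ p τ ∈ U := by
  have hsub : Icc a b ⊆ Icc (0 : ℝ) 1 := Icc_subset_Icc ha hb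
  have h : ∀ᶠ p in 𝓝 p₀, ∀ τ ∈ Icc a b, τ ∈ Icc a b → Γ p τ ∈ U := by
    refine isCompact_Icc.eventually_forall_of_forall_eventually fun τ hτ => ?_
    have h1 := hΓ (p₀, τ) ⟨mem_of_mem_nhds hN, hsub hτ⟩
    have h2 := h1.preimage_mem_nhdsWithin (hU.mem_nhds (by
      rw [h0 τ (hsub hτ)]; exact hδ τ hτ))
    have h3 := eventually_nhdsWithin_iff.1 h2
    have h4 : ∀ᶠ z : P × ℝ in 𝓝 (p₀, τ), z.1 ∈ N := continuous_fst.continuousAt hN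
    filter_upwards [h3, h4] with z hz hz' hz'' using hz ⟨hz', hsub hz''⟩
  filter_upwards [h] with p hp τ hτ using hp τ hτ hτ

variable [ChartedSpace C2 M] [IsManifold 𝓘(ℂ, C2) ω M]
  {L : M → Type*} [TopologicalSpace (TotalSpace ℂ L)]
  [∀ x, AddCommGroup (L x)] [∀ x, Module ℂ (L x)] [∀ x, TopologicalSpace (L x)]
  [FiberBundle ℂ L] [VectorBundle ℂ ℂ L]

theorem continuousOn_of_tangentBundle {P : Type*} [TopologicalSpace P] {S : Set (P × ℝ)}
    {Γ : P → ℝ → M} (h : ContinuousOn (fun q : P × ℝ =>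
      (⟨Γ q.1 q.2, velocity (Γ q.1) q.2⟩ : TangentBundle 𝓘(ℂ, C2) M)) S) :
    ContinuousOn (fun q : P × ℝ => Γ q.1 q.2) S :=
  (FiberBundle.continuous_proj C2 (TangentSpace 𝓘(ℂ, C2))).comp_continuousOn h

/-- `η = s df` vanishes exactly where `df` does. -/
theorem dif_eq_zero_iff {η : TwistedForm L} {s : ∀ x : M, L x} {f : M → ℂ} {x : M}
    {v : TangentSpace 𝓘(ℂ, C2) x} (hs : s x ≠ 0) (h : η x v = dif f x v • s x) :
    dif f x v = 0 ↔ η x v = 0 := by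
  refine ⟨fun h0 => by rw [h, h0, zero_smul], fun h0 => ?_⟩
  rw [← formQuot_eq_of_smul hs h]
  exact formQuot_eq_of_smul hs (by rw [h0, zero_smul])

variable [∀ x, IsTopologicalAddGroup (L x)] [∀ x, ContinuousSMul ℂ (L x)]

/-- The derivative of the holonomy with respect to the parameter of the deformation. -/
theorem hasDerivAt_of_leafPaths {η : ℂ → TwistedForm L} {c : ℕ → TwistedForm L}
    (hη : IsHolomorphicDeformation η c) {s : ∀ x : M, L x} {Ds Df : Set M}
    (hs : IsMeromorphicSection s Ds) {f : M → ℂ} (hf : IsMeromorphicFunction f Df)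
    (hsf : ∀ x ∈ Ds ∩ Df, ∀ v : TangentSpace 𝓘(ℂ, C2) x, η 0 x v = dif f x v • s x)
    {Γ : ℂ → ℝ → M} {N : Set ℂ} (hN : N ∈ 𝓝 0) (hleaf : ∀ ε ∈ N, IsLeafPath (η ε) (Γ ε))
    (hΓ : ContinuousOn (fun q : ℂ × ℝ =>
      (⟨Γ q.1 q.2, velocity (Γ q.1) q.2⟩ : TangentBundle 𝓘(ℂ, C2) M)) (N ×ˢ Icc (0 : ℝ) 1))
    (hreg : ∀ᶠ ε in 𝓝 (0 : ℂ), ∀ τ ∈ Icc (0 : ℝ) 1, Γ ε τ ∈ regularSet s (Ds ∩ Df))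
    {k : ℂ → ℂ} {t : ℂ} (hstart : ∀ᶠ ε in 𝓝 (0 : ℂ), f (Γ ε 0) = t)
    (hend : ∀ᶠ ε in 𝓝 (0 : ℂ), f (Γ ε 1) = k ε) (hk : k 0 = t) :
    HasDerivAt k (-∫ τ in (0 : ℝ)..1, formQuot (c 1) s (Γ 0 τ) (velocity (Γ 0) τ)) 0 := by
  set g : ℂ → ℝ → ℂ := fun ε τ =>
    formQuot (slopeForm η (c 1) ε) s (Γ ε τ) (velocity (Γ ε) τ) with hg
  -- Tangency to the kernel of `η ε` leaves only the term $-\epsilon^{-1}\omega_0$ of the quotient,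
  -- and $\omega_0=s\,df$.
  have hgd : ∀ᶠ ε in 𝓝[≠] (0 : ℂ), ∀ τ ∈ Icc (0 : ℝ) 1,
      g ε τ = -ε⁻¹ * dif f (Γ ε τ) (velocity (Γ ε) τ) := by
    filter_upwards [nhdsWithin_le_nhds hreg, nhdsWithin_le_nhds hN, self_mem_nhdsWithin]
      with ε h1 h2 h3 τ hτ
    refine formQuot_eq_of_smul (h1 τ hτ).2 ?_
    rw [slopeForm_of_ne η (c 1) h3]
    change ε⁻¹ • (η ε (Γ ε τ) (velocity (Γ ε) τ) - η 0 (Γ ε τ) (velocity (Γ ε) τ)) = _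
    rw [((hleaf ε h2).2 τ hτ).2, hsf _ (h1 τ hτ).1, zero_sub, smul_neg, smul_smul, neg_mul,
      neg_smul]
  have hfω : ∀ x ∈ regularSet s (Ds ∩ Df), ContMDiffAt 𝓘(ℂ, C2) 𝓘(ℂ, ℂ) 1 f x := fun x hx =>
    (hf.holo.contMDiffAt (hf.isOpen.mem_nhds hx.1.2)).of_le (by simp)
  have hint : ∀ᶠ ε in 𝓝[≠] (0 : ℂ), IntervalIntegrable (g ε) MeasureTheory.volume 0 1 ∧
      ∫ τ in (0 : ℝ)..1, g ε τ = -(ε⁻¹ * (k ε - t)) := by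
    filter_upwards [hgd, nhdsWithin_le_nhds hreg, nhdsWithin_le_nhds hN,
      nhdsWithin_le_nhds hstart, nhdsWithin_le_nhds hend] with ε h1 h2 h3 h4 h5
    have hd := intervalIntegrable_dif_velocity (hleaf ε h3).1 fun τ hτ => hfω _ (h2 τ hτ)
    have he := integral_dif_velocity (hleaf ε h3).1 fun τ hτ => hfω _ (h2 τ hτ)
    have hcongr : EqOn (g ε) (fun τ => -ε⁻¹ * dif f (Γ ε τ) (velocity (Γ ε) τ)) (uIcc 0 1) := by
      rw [uIcc_of_le zero_le_one]; exact h1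
    constructor
    · exact (hd.const_mul (-ε⁻¹)).congr (hcongr.symm.mono uIoc_subset_uIcc)
    · rw [intervalIntegral.integral_congr hcongr, intervalIntegral.integral_const_mul, he, h4, h5]
      ring
  -- At $\epsilon=0$ the integrand is $\omega_1/s$ by the completion of `slopeForm`; the
  -- $C^1$-continuity of the lifts is what makes the velocities converge.
  have hlim : ∀ τ ∈ Icc (0 : ℝ) 1,
      Tendsto (fun z : ℂ × ℝ => g z.1 z.2) (𝓝 0 ×ˢ 𝓝[Icc 0 1] τ) (𝓝 (g 0 τ)) := by
    intro τ hτ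
    have hx := hreg.self_of_nhds τ hτ
    have h1 := tendsto_formQuot_slopeForm hη hs
      (v₀ := ⟨Γ 0 τ, velocity (Γ 0) τ⟩) hx.1.1 hx.2
    have h2 : Tendsto (fun q : ℂ × ℝ =>
        (⟨Γ q.1 q.2, velocity (Γ q.1) q.2⟩ : TangentBundle 𝓘(ℂ, C2) M))
        (𝓝 0 ×ˢ 𝓝[Icc 0 1] τ) (𝓝 ⟨Γ 0 τ, velocity (Γ 0) τ⟩) := by
      have h3 := (hΓ (0, τ) ⟨mem_of_mem_nhds hN, hτ⟩).tendsto
      rwa [nhdsWithin_prod_eq, nhdsWithin_eq_nhds.2 hN] at h3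
    have h4 : g 0 τ = formQuot (c 1) s (Γ 0 τ) (velocity (Γ 0) τ) := by
      rw [hg]; beta_reduce; rw [slopeForm_zero]
    rw [h4]
    have h5 : Tendsto (fun q : ℂ × ℝ =>
        (q.1, (⟨Γ q.1 q.2, velocity (Γ q.1) q.2⟩ : TangentBundle 𝓘(ℂ, C2) M)))
        (𝓝 0 ×ˢ 𝓝[Icc 0 1] τ) (𝓝 0 ×ˢ 𝓝 ⟨Γ 0 τ, velocity (Γ 0) τ⟩) :=
      tendsto_fst.prodMk h2
    have h6 := h1.comp h5
    exact h6
  have hmain := (tendsto_integral_of_tendsto_prod hlim (hint.mono fun _ h => h.1)).neg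
  have h0 : ∀ τ, g 0 τ = formQuot (c 1) s (Γ 0 τ) (velocity (Γ 0) τ) := fun τ => by
    rw [hg]; beta_reduce; rw [slopeForm_zero]
  simp only [h0] at hmain
  rw [hasDerivAt_iff_tendsto_slope]
  refine hmain.congr' ?_
  filter_upwards [hint] with ε hε
  rw [hε.2, slope_def_field, hk, sub_zero, neg_neg, div_eq_inv_mul]

end Melnikov

end

end MelnikovFoliation

/-! ### The formula for the first Melnikov function -/

theorem proposition3p1
    {M : Type*} [TopologicalSpace M] [T2Space M] [CompactSpace M]
    [ChartedSpace C2 M] [IsManifold 𝓘(ℂ, C2) ω M]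
    {L : M → Type*} [TopologicalSpace (TotalSpace ℂ L)]
    [∀ x, AddCommGroup (L x)] [∀ x, Module ℂ (L x)] [∀ x, TopologicalSpace (L x)]
    [∀ x, IsTopologicalAddGroup (L x)] [∀ x, ContinuousSMul ℂ (L x)]
    [FiberBundle ℂ L] [VectorBundle ℂ ℂ L] [ContMDiffVectorBundle ω ℂ L 𝓘(ℂ, C2)]
    -- the deformation `η ε = η 0 + ε c 1 + ε² c 2 + ⋯`
    (η : ℂ → MelnikovFoliation.TwistedForm L) (c : ℕ → MelnikovFoliation.TwistedForm L)
    (hη : MelnikovFoliation.IsHolomorphicDeformation η c)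
    -- the integrating factor `s` and the first integral `f`, with `η 0 = s df`
    (s : ∀ x : M, L x) (Ds : Set M) (hs : MelnikovFoliation.IsMeromorphicSection s Ds)
    (f : M → ℂ) (Df : Set M) (hf : MelnikovFoliation.IsMeromorphicFunction f Df)
    (hsf : ∀ x ∈ Ds ∩ Df, ∀ v : TangentSpace 𝓘(ℂ, C2) x,
      η 0 x v = MelnikovFoliation.dif f x v • s x)
    -- the cycle `δ` in a leaf, off the divisor of `s`
    (δ : ℝ → M) (hδ : MelnikovFoliation.IsLeafPath (η 0) δ) (hδ_loop : δ 1 = δ 0)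
    (hδ_reg : ∀ τ ∈ Icc (0 : ℝ) 1, δ τ ∈ Ds ∩ Df ∧ s (δ τ) ≠ 0)
    -- the transverse section, parameterized by `t = f`
    (σ : ℂ → M) (hσ : ContMDiffAt 𝓘(ℂ, ℂ) 𝓘(ℂ, C2) ω σ 0) (hσ_base : σ 0 = δ 0)
    (hσ_param : ∀ᶠ t in 𝓝 (0 : ℂ), f (σ t) = t)
    -- the holonomy of the deformation, equal to the identity for `ε = 0`
    (h : ℂ → ℂ → ℂ) (hh : MelnikovFoliation.IsHolonomy η δ σ h)
    (hid : ∀ᶠ t in 𝓝 (0 : ℂ), h 0 t = t)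
    -- the closed lifts `Δ t` of `δ` to the leaves of `η 0` through the points `σ t`
    (Δ : ℂ → ℝ → M) (hΔ : MelnikovFoliation.IsLeafLift (fun _ : ℂ => η 0) δ 0 σ σ Δ) :
    ∀ᶠ t in 𝓝 (0 : ℂ),
      DifferentiableAt ℂ (fun ε => h ε t) 0 ∧
      IntervalIntegrable (fun τ => MelnikovFoliation.formQuot (c 1) s (Δ t τ)
        (MelnikovFoliation.velocity (Δ t) τ)) MeasureTheory.volume 0 1 ∧
      MelnikovFoliation.melnikov h 1 t =
        -∫ τ in (0 : ℝ)..1, MelnikovFoliation.formQuot (c 1) s (Δ t τ)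
          (MelnikovFoliation.velocity (Δ t) τ) := by
  obtain ⟨hh_lim, Γ, hΓ0, N, hN, hΓN, hΓc⟩ := hh
  obtain ⟨hΔ0, N', hN', hΔN, hΔc⟩ := hΔ
  have hRopen : IsOpen (MelnikovFoliation.regularSet s (Ds ∩ Df)) :=
    MelnikovFoliation.isOpen_regularSet hs hf.isOpen
  have hΓcont := MelnikovFoliation.continuousOn_of_tangentBundle hΓc
  have hΔcont := MelnikovFoliation.continuousOn_of_tangentBundle hΔc
  have hslice : Tendsto (fun t : ℂ => (t, (0 : ℂ))) (𝓝 0) (𝓝 (0, 0)) :=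
    (Continuous.prodMk_left (0 : ℂ)).tendsto 0
  -- Where $s\ne0$, the kernels of $\omega_0=s\,df$ and of $df$ coincide, so leaf paths lie in
  -- levels of $f$.
  have hlevel : ∀ {γ : ℝ → M}, MelnikovFoliation.IsLeafPath (η 0) γ →
      (∀ τ ∈ Icc (0 : ℝ) 1, γ τ ∈ MelnikovFoliation.regularSet s (Ds ∩ Df)) →
      ∀ τ ∈ Icc (0 : ℝ) 1, f (γ τ) = f (γ 0) := fun hγ hreg =>
    MelnikovFoliation.eq_of_dif_velocity_eq_zero hγ.1
      (fun τ hτ => (hf.holo.contMDiffAt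
        (hf.isOpen.mem_nhds (hreg τ hτ).1.2)).mdifferentiableAt (by simp))
      fun τ hτ => (MelnikovFoliation.dif_eq_zero_iff (hreg τ hτ).2
        (hsf _ (hreg τ hτ).1 _)).2 (hγ.2 τ hτ).2
  have hevΓ : ∀ᶠ p : ℂ × ℂ in 𝓝 (0, 0),
      (∀ τ ∈ Icc (0 : ℝ) 1, Γ p τ ∈ MelnikovFoliation.regularSet s (Ds ∩ Df)) ∧ p ∈ N ∧
        f (Γ p 0) = p.1 ∧ f (Γ p 1) = h p.2 p.1 := by
    -- The identity $f(\sigma(t))=t$ is known only near $0$; at the final point it applies because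
    -- $h_\epsilon(t)\to0$.
    filter_upwards [MelnikovFoliation.eventually_forall_mem_of_continuousOn hN hΓcont hΓ0 le_rfl
      le_rfl hRopen hδ_reg, hN, (continuous_fst.tendsto ((0 : ℂ), (0 : ℂ))).eventually hσ_param,
      hh_lim.eventually hσ_param] with p h1 h2 h3 h4
    refine ⟨h1, h2, ?_, ?_⟩
    · rw [(hΓN p h2).2.1, h3]
    · rw [(hΓN p h2).2.2, h4]
  have hevΔ : ∀ᶠ t : ℂ in 𝓝 0,
      ∀ τ ∈ Icc (0 : ℝ) 1, Δ t τ ∈ MelnikovFoliation.regularSet s (Ds ∩ Df) :=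
    MelnikovFoliation.eventually_forall_mem_of_continuousOn hN' hΔcont hΔ0 le_rfl le_rfl hRopen
      hδ_reg
  have hagree := MelnikovFoliation.eventually_integral_eq (l := 𝓝 (0 : ℂ)) (hη.1 1) hs hf
    hδ.1.continuousOn hδ_reg
    -- A leaf path avoids the zeros of $\omega_0$, hence $df\neq0$ along $\delta$ and flow boxes
    -- exist there.
    (fun τ hτ => by
      by_contra! h0
      refine (hδ.2 τ hτ).1 (ContinuousLinearMap.ext fun v => ?_)
      exact (MelnikovFoliation.dif_eq_zero_iff (hδ_reg τ hτ).2 (hsf _ (hδ_reg τ hτ).1 v)).1 (h0 v))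
    (w := fun t => t) (Γ := fun t => Γ (t, 0)) (Δ := Δ)
    (by
      filter_upwards [hslice.eventually hevΓ, hevΔ, hN', hid, hσ_param] with t h1 h2 h3 h4 h5
      obtain ⟨hΓleaf, hΓa, hΓb⟩ := hΓN (t, 0) h1.2.1
      obtain ⟨hΔleaf, hΔa, hΔb⟩ := hΔN t h3
      refine ⟨hΓleaf.1, hΔleaf.1, fun τ hτ => ⟨?_, ?_⟩, hΓa.trans hΔa.symm, ?_⟩
      · rw [hlevel hΓleaf h1.1 τ hτ, h1.2.2.1]
      · rw [hlevel hΔleaf h2 τ hτ, hΔa, h5]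
      · exact hΓb.trans ((congrArg σ h4).trans hΔb.symm))
    (fun a b ha hb U hU hδU => by
      filter_upwards [hslice.eventually (MelnikovFoliation.eventually_forall_mem_of_continuousOn hN
        hΓcont hΓ0 ha hb hU hδU), MelnikovFoliation.eventually_forall_mem_of_continuousOn hN'
        hΔcont hΔ0 ha hb hU hδU] with t h1 h2 τ hτ using ⟨h1 τ hτ, h2 τ hτ⟩)
  -- From here $t$ is fixed; currying turns the joint neighbourhood of $(0,0)$ into statements for
  -- $\epsilon$ near $0$.
  filter_upwards [hagree, hevΓ.curry_nhds, hid] with t h1 h2 h3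
  have hNt : {ε : ℂ | (t, ε) ∈ N} ∈ 𝓝 0 := h2.mono fun ε hε => hε.2.1
  have hderiv := MelnikovFoliation.hasDerivAt_of_leafPaths hη hs hf hsf
    (Γ := fun ε => Γ (t, ε)) (k := fun ε => h ε t) (t := t) hNt
    (fun ε hε => (hΓN (t, ε) hε).1)
    (hΓc.comp (f := fun q : ℂ × ℝ => ((t, q.1), q.2)) (by fun_prop) fun q hq => ⟨hq.1, hq.2⟩)
    (h2.mono fun ε hε => hε.1) (h2.mono fun ε hε => hε.2.2.1)
    (h2.mono fun ε hε => hε.2.2.2) h3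
  refine ⟨hderiv.differentiableAt, h1.1, ?_⟩
  rw [← h1.2, MelnikovFoliation.melnikov, iteratedDeriv_one, deriv_sub_const, hderiv.deriv]
  simp
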